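/- Let $0<k<1$, let $T>\dfrac{e^{2k(1+k)/(1-k)^3}-1}{k}$, let $\tilde\sigma>0$, put $\Omega_t=(0,1+kt)$ and $\widehat Q=\{(x,t):0<t<T,\ x\in\Omega_t\}$, and let $\tilde u_2\in L^2(\widehat Q)$. For controls $\tilde w_1$ (leader) and $\tilde w_2$ (follower) in $L^2(0,T)$, both acting at the fixed end $x=0$, let $u=u(\tilde w_1,\tilde w_2)\in C([0,T];L^2(\Omega_t))$ be the solution in the sense of transposition of $$u''-u_{xx}=0\ \text{in }\widehat Q,\qquad u(0,t)=\tilde w_1(t)+\tilde w_2(t),\quad u(1+kt,t)=0\quad(0<t<T),\qquad u(\cdot,0)=u'(\cdot,0)=0,$$ that is, $$\iint_{\widehat Q}u\,(\theta''-\theta_{xx})\,dx\,dt=\int_0^T(\tilde w_1+\tilde w_2)(t)\,\theta_x(0,t)\,dt$$ for all $\theta\in C^2(\mathbb R^2)$ such that $\theta(0,t)=\theta(1+kt,t)=0$ for $0\le t\le T$ and $\theta(\cdot,T)=\theta'(\cdot,T)=0$ on $\overline{\Omega_T}$. (Here $'=\partial_t$.) Call $\tilde w_2$ a Nash equilibrium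 for $\tilde w_1$ if it minimizes over $L^2(0,T)$ the functional $$\tilde J_2(\tilde w_1,\cdot)\colon\ \tilde w_2\longmapsto\frac12\iint_{\widehat Q}\big(u(\tilde w_1,\tilde w_2)-\tilde u_2\big)^2dx\,dt+\frac{\tilde\sigma}{2}\int_0^T\tilde w_2^2\,dt .$$ Then every leader $\tilde w_1\in L^2(0,T)$ has exactly one Nash equilibrium $\tilde w_2$; the corresponding final state $(u(T),u'(T))\in L^2(\Omega_T)\times H^{-1}(\Omega_T)$ exists and is unique, where $u'(T)$ is the one-sided derivative at $T$, in the norm of $H^{-1}(\Omega_T)$, of $t\mapsto u(t)$ extended by zero to $\Omega_T$; and as $\tilde w_1$ ranges over $L^2(0,T)$ these final states form a dense subset of $L^2(\Omega_T)\times H^{-1}(\Omega_T)$. -/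

import Mathlib

open MeasureTheory Set Filter Topology
open scoped ContDiff

noncomputable section

namespace MovingString

/-! ### Domains and function spaces -/

/-- The moving interval `Ω_t = (0, 1 + k t)`. -/
def Om (k t : ℝ) : Set ℝ := Ioo 0 (1 + k * t)

/-- The non-cylindrical domain `{(x, t) : 0 < t < T, 0 < x < 1 + k t}`. -/
def Q (k T : ℝ) : Set (ℝ × ℝ) := {p | p.2 ∈ Ioo 0 T ∧ p.1 ∈ Om k p.2}

/-- The real space `L²(s)`. -/
abbrev L2 {α : Type} [MeasureSpace α] (s : Set α) : Type := Lp ℝ 2 ((volume : Measure α).restrict s)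

/-- Controls: the space `L²` of the fixed end `{0} × (0, T)`. -/
abbrev Control (T : ℝ) : Type := L2 (Ioo (0 : ℝ) T)

/-- The pairs `(φ, φ')` with `φ ∈ C_c^∞(I)`, as a subspace of `L²(I) × L²(I)` with the Hilbert
norm; the norm of such a pair is the `H¹` norm of `φ`. -/
def testGraph (I : Set ℝ) : Submodule ℝ (WithLp 2 (L2 I × L2 I)) where
  carrier := {p | ∃ φ : ℝ → ℝ, ContDiff ℝ ∞ φ ∧ HasCompactSupport φ ∧ tsupport φ ⊆ I ∧
    p.fst =ᵐ[volume.restrict I] φ ∧ p.snd =ᵐ[volume.restrict I] deriv φ}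
  zero_mem' := by
    refine ⟨0, contDiff_const, HasCompactSupport.zero, by simp, ?_, ?_⟩
    · exact Lp.coeFn_zero _ _ _
    · have h : deriv (0 : ℝ → ℝ) = 0 := by ext x; simp
      rw [h]
      exact Lp.coeFn_zero _ _ _
  add_mem' := by
    rintro a b ⟨φ, h1, h2, h3, h4, h5⟩ ⟨χ, g1, g2, g3, g4, g5⟩
    refine ⟨φ + χ, h1.add g1, h2.add g2, (tsupport_add φ χ).trans (union_subset h3 g3), ?_, ?_⟩
    · exact (Lp.coeFn_add a.fst b.fst).trans (h4.add g4)
    · have h : deriv (φ + χ) = deriv φ + deriv χ := by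
        ext x
        exact deriv_add (h1.differentiable (by simp) x) (g1.differentiable (by simp) x)
      rw [h]
      exact (Lp.coeFn_add a.snd b.snd).trans (h5.add g5)
  smul_mem' := by
    rintro c a ⟨φ, h1, h2, h3, h4, h5⟩
    refine ⟨c • φ, h1.const_smul c, h2.smul_left (f := fun _ => c), ?_, ?_, ?_⟩
    · exact (closure_mono (Function.support_const_smul_subset c φ)).trans h3
    · exact (Lp.coeFn_smul c a.fst).trans (h4.const_smul c)
    · have h : deriv (c • φ) = c • deriv φ := by
        ext x
        exact deriv_const_smul c (h1.differentiable (by simp) x)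
      rw [h]
      exact (Lp.coeFn_smul c a.snd).trans (h5.const_smul c)

/-- `H¹₀(I)`: the closure of `C_c^∞(I)` in the `H¹` norm. An element is a pair `(f, f')`. -/
abbrev H10 (I : Set ℝ) : Submodule ℝ (WithLp 2 (L2 I × L2 I)) := (testGraph I).topologicalClosure

/-- `H⁻¹(I)`: the dual space of `H¹₀(I)`, with the operator norm. -/
abbrev Hm1 (I : Set ℝ) : Type := H10 I →L[ℝ] ℝ

/-- The canonical embedding `L²(I) → H⁻¹(I)`, `y ↦ (f ↦ ∫_I y f)`. -/
def toHm1 {I : Set ℝ} (y : L2 I) : Hm1 I :=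
  (innerSL ℝ (WithLp.toLp 2 (y, (0 : L2 I)))).comp (H10 I).subtypeL

/-! ### The state equation -/

/-- Test functions of the transposition method: `θ = θ(x, t)` is of class `C²`, vanishes on both
lateral boundaries `x = 0` and `x = 1 + k t`, and has `θ(T) = θ'(T) = 0`. Such a `θ` is the
solution of the backward adjoint problem with source `θ'' - θ_xx`. -/
structure IsTest (k T : ℝ) (θ : ℝ × ℝ → ℝ) : Prop where
  smooth : ContDiff ℝ 2 θ
  left : ∀ t ∈ Icc 0 T, θ (0, t) = 0
  right : ∀ t ∈ Icc 0 T, θ (1 + k * t, t) = 0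
  final : ∀ x ∈ Icc 0 (1 + k * T), θ (x, T) = 0
  final_velocity : ∀ x ∈ Icc 0 (1 + k * T), deriv (fun s => θ (x, s)) T = 0

/-- The d'Alembertian `θ'' - θ_xx`. -/
def box (θ : ℝ × ℝ → ℝ) (p : ℝ × ℝ) : ℝ :=
  iteratedDeriv 2 (fun s => θ (p.1, s)) p.2 - iteratedDeriv 2 (fun y => θ (y, p.2)) p.1

/-- `U` is the solution by transposition, in the class `C([0,T]; L²(Ω_t))`, of
`u'' - u_xx = 0` in `Q`, `u = w` at the end `x = 0`, `u = 0` at the end `x = 1 + k t`,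
`u(0) = u'(0) = 0`.

The solution appears as the element `U` of `L²(Q)` and as the continuous curve `t ↦ u t`,
where `u t ∈ L²(Ω_t)` is extended by zero to `Ω_T ⊇ Ω_t`. -/
structure IsState (k T : ℝ) (w : Control T) (U : L2 (Q k T)) (u : ℝ → L2 (Om k T)) : Prop where
  continuousOn : ContinuousOn u (Icc 0 T)
  support : ∀ t ∈ Icc 0 T, ∀ᵐ x ∂(volume.restrict (Om k T)), x ∉ Om k t → u t x = 0
  slice : ∀ᵐ t ∂(volume.restrict (Ioo 0 T)), ∀ᵐ x ∂(volume.restrict (Om k t)), U (x, t) = u t x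
  transposition : ∀ θ : ℝ × ℝ → ℝ, IsTest k T θ →
    (∫ p in Q k T, U p * box θ p) = ∫ t in Ioo 0 T, w t * deriv (fun x => θ (x, t)) 0

/-- The pair `z = (u(T), u'(T))` in `L²(Ω_T) × H⁻¹(Ω_T)` of the solution with boundary value `w`
at `x = 0`; the velocity `u'(T)` is the (one-sided) time derivative at `T` in the norm of
`H⁻¹(Ω_T)`. -/
def IsFinalState (k T : ℝ) (w : Control T) (z : L2 (Om k T) × Hm1 (Om k T)) : Prop :=
  ∃ U u, IsState k T w U u ∧ u T = z.1 ∧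
    HasDerivWithinAt (fun t => toHm1 (u t)) z.2 (Icc 0 T) T

/-! ### The follower -/

/-- The cost `½ ∬_Q (u - ũ₂)² dx dt + (σ/2) ∫ w₂² dt` of the follower. -/
def cost (k T σ : ℝ) (ut : L2 (Q k T)) (U : L2 (Q k T)) (w₂ : Control T) : ℝ :=
  (1 / 2) * (∫ p in Q k T, (U p - ut p) ^ 2) + (σ / 2) * (∫ t in Ioo 0 T, (w₂ t) ^ 2)

/-- `w₂` is a Nash equilibrium for the leader `w₁`: the state with boundary value `w₁ + w₂` at
`x = 0` exists, and `w₂` minimizes the cost of the follower among all his controls. -/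
def IsNash (k T σ : ℝ) (ut : L2 (Q k T)) (w₁ w₂ : Control T) : Prop :=
  ∃ U u, IsState k T (w₁ + w₂) U u ∧
    ∀ (v₂ : Control T) (V : L2 (Q k T)) (v : ℝ → L2 (Om k T)),
      IsState k T (w₁ + v₂) V v → cost k T σ ut U w₂ ≤ cost k T σ ut V v₂

end MovingString

end

/-! The equilibrium condition of the follower is `σ w₂ + S* (S (w₁ + w₂) - ũ₂) = 0`, where `S` is
the operator from the boundary value to the state. It involves the leader only through the sum `w =
w₁ + w₂`. Hence any prescribed `w` splits: take `w₂ = σ⁻¹ S* (ũ₂ - S w)` and `w₁ = w - w₂`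
(`exists_isNash_add_eq`). The final states reached under Nash equilibria are therefore all final
states of the string with a single control, and the set is not merely dense but everything, by exact
controllability (`exists_control`).

Exact controllability comes from d'Alembert's formula `u(x, t) = F (t - x) - F (ρ (t + x))`, `ρ =
reflect k`, where `ρ` is chosen so that `u` vanishes at the moving end. The control is `w = F - F ∘
ρ`. At time `T` put `p(x) = F (T - x)` and `r(x) = F (ρ (T + x))`; then `u(T) = p - r` and `u'(T) =
-(p + r)'`. The values of `F` used by `p` and by `r` lie on disjoint intervals, both in `t > 0` as
soon as `T > 2 / (1 - k)`, so `p` and `r` are arbitrary in `L²`. Every element of `H⁻¹` is the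
derivative of an `L²` function (`gradPairing_surjective`), so every pair is reached.

Three facts make this rigorous. The formula satisfies the transposition identity
(`transposition_identity`). Transposition solutions are unique, because the sources `a(t - x) b(t +
x)` of explicit test functions are total (`eq_zero_of_forall_isTest`); this also makes `S` well
defined and, by the closed graph theorem, bounded. Finally, the truncated travelling waves are
differentiable at `T` in `H⁻¹` (`hasDerivWithinAt_toHm1`). Existence and uniqueness of the
equilibrium is then the minimization of a coercive quadratic functional. -/

noncomputable section

namespace MovingString

/-! ### Integration in characteristic coordinates -/

lemma measurePreserving_charLeft :
    MeasurePreserving (fun z : ℝ × ℝ => (z.2 - z.1, z.2)) volume volume := by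
  have h1 := measurePreserving_sub_prod (volume : Measure ℝ) (volume : Measure ℝ)
  have h2 := (Measure.measurePreserving_neg (volume : Measure ℝ)).prod
    (MeasurePreserving.id (volume : Measure ℝ))
  have h3 := h2.comp h1
  have h : (Prod.map Neg.neg id ∘ fun z : ℝ × ℝ => (z.1 - z.2, z.2))
      = fun z : ℝ × ℝ => (z.2 - z.1, z.2) := by
    ext z <;> simp
  rw [h] at h3
  exact h3

lemma measurePreserving_charRight :
    MeasurePreserving (fun z : ℝ × ℝ => (z.1 - z.2, z.2)) volume volume :=
  measurePreserving_sub_prod (volume : Measure ℝ) (volume : Measure ℝ)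

lemma measurePreserving_charRight_symm :
    MeasurePreserving (fun z : ℝ × ℝ => (z.1 + z.2, z.2)) volume volume :=
  measurePreserving_add_prod (volume : Measure ℝ) (volume : Measure ℝ)

lemma integral_eq_of_measurePreserving {e : ℝ × ℝ → ℝ × ℝ} (he : MeasurePreserving e volume volume)
    {g : ℝ × ℝ → ℝ} (hg : Integrable g) : ∫ p, g p = ∫ x, ∫ t, g (e (x, t)) := by
  have h1 : Integrable (g ∘ e) := he.integrable_comp_of_integrable hg
  have h2 : ∫ p, g p = ∫ p, g (e p) := by
    conv_lhs => rw [← he.map_eq]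
    refine integral_map he.measurable.aemeasurable ?_
    rw [he.map_eq]
    exact hg.aestronglyMeasurable
  rw [h2]
  exact integral_prod _ h1

lemma integral_charLeft {g : ℝ × ℝ → ℝ} (hg : Integrable g) :
    ∫ p, g p = ∫ ξ, ∫ t, g (t - ξ, t) :=
  integral_eq_of_measurePreserving measurePreserving_charLeft hg

lemma integral_charRight {g : ℝ × ℝ → ℝ} (hg : Integrable g) :
    ∫ p, g p = ∫ η, ∫ t, g (η - t, t) :=
  integral_eq_of_measurePreserving measurePreserving_charRight hg

/-! ### The domain -/

lemma measurableSet_Q (k T : ℝ) : MeasurableSet (Q k T) := by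
  have : Q k T = {p : ℝ × ℝ | 0 < p.2} ∩ {p | p.2 < T} ∩ {p | 0 < p.1} ∩
      {p | p.1 < 1 + k * p.2} := by
    ext p; simp only [Q, Om, mem_ofPred_eq, mem_Ioo, mem_inter_iff]; tauto
  rw [this]
  exact (((measurableSet_lt measurable_const measurable_snd).inter
    (measurableSet_lt measurable_snd measurable_const)).inter
    (measurableSet_lt measurable_const measurable_fst)).inter
    (measurableSet_lt measurable_fst (by fun_prop))

lemma isOpen_Q (k T : ℝ) : IsOpen (Q k T) := by
  have : Q k T = {p : ℝ × ℝ | 0 < p.2} ∩ {p | p.2 < T} ∩ {p | 0 < p.1} ∩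
      {p | p.1 < 1 + k * p.2} := by
    ext p; simp only [Q, Om, mem_ofPred_eq, mem_Ioo, mem_inter_iff]; tauto
  rw [this]
  exact (((isOpen_lt continuous_const continuous_snd).inter
    (isOpen_lt continuous_snd continuous_const)).inter
    (isOpen_lt continuous_const continuous_fst)).inter
    (isOpen_lt continuous_fst (by fun_prop))

lemma Q_subset {k T : ℝ} (hk : 0 < k) : Q k T ⊆ Icc 0 (1 + k * T) ×ˢ Icc 0 T := by
  rintro ⟨x, t⟩ ⟨⟨h1, h2⟩, h3, h4⟩
  simp only [mem_prod, mem_Icc] at *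
  exact ⟨⟨h3.le, by nlinarith⟩, h1.le, h2.le⟩

lemma volume_Q_lt_top {k T : ℝ} (hk : 0 < k) : volume (Q k T) < ⊤ :=
  (measure_mono (Q_subset hk)).trans_lt (isCompact_Icc.prod isCompact_Icc).measure_lt_top

lemma memLp_continuous_Q {k T : ℝ} (hk : 0 < k) {f : ℝ × ℝ → ℝ} (hf : Continuous f) :
    MemLp f 2 (volume.restrict (Q k T)) := by
  have : IsFiniteMeasure (volume.restrict (Q k T)) := ⟨by simpa using volume_Q_lt_top hk⟩
  obtain ⟨C, hC⟩ := (isCompact_Icc.prod isCompact_Icc :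
    IsCompact (Icc 0 (1 + k * T) ×ˢ Icc 0 T)).exists_bound_of_continuousOn hf.continuousOn
  refine MemLp.of_bound hf.aestronglyMeasurable C ?_
  exact (ae_restrict_iff' (measurableSet_Q k T)).2 (.of_forall fun p hp => hC p (Q_subset hk hp))

/-! ### Profiles of travelling waves -/

lemma memLp_comp_affine {F : ℝ → ℝ} (hF : MemLp F 2) {c : ℝ} (hc : c ≠ 0) (d : ℝ) :
    MemLp (fun t => F (c * t + d)) 2 := by
  have h1 : MemLp (fun t => F (t + d)) 2 :=
    hF.comp_measurePreserving (measurePreserving_add_right volume d)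
  have h2 := Real.map_volume_mul_left hc
  have h3 : MemLp (fun t => F (t + d)) 2 (Measure.map (c * ·) volume) := by
    rw [h2]; exact h1.smul_measure ENNReal.ofReal_ne_top
  exact (memLp_map_measure_iff h3.aestronglyMeasurable (by fun_prop)).1 h3

lemma memLp_comp_fst_Q {k T : ℝ} {F : ℝ → ℝ} (hF : MemLp F 2) {e : ℝ × ℝ → ℝ × ℝ}
    (he : MeasurePreserving e volume volume) (h2 : ∀ p, (e p).2 = p.2) :
    MemLp (fun p => F (e p).1) 2 (volume.restrict (Q k T)) := by
  have h : MemLp (fun p : ℝ × ℝ => F p.1) 2 (volume.restrict (univ ×ˢ Ioo 0 T)) := by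
    rw [Measure.volume_eq_prod, ← Measure.prod_restrict, Measure.restrict_univ]
    exact hF.comp_fst (volume.restrict (Ioo 0 T))
  have h3 := h.comp_measurePreserving (he.restrict_preimage (by measurability))
  refine h3.mono_measure (Measure.restrict_mono ?_ le_rfl)
  rintro p ⟨hp, -⟩
  exact ⟨trivial, by rw [h2]; exact hp⟩

lemma memLp_left_Q {k T : ℝ} {F : ℝ → ℝ} (hF : MemLp F 2) :
    MemLp (fun p : ℝ × ℝ => F (p.2 - p.1)) 2 (volume.restrict (Q k T)) :=
  memLp_comp_fst_Q hF measurePreserving_charLeft fun _ => rfl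

lemma memLp_right_Q {k T : ℝ} {F : ℝ → ℝ} (hF : MemLp F 2) :
    MemLp (fun p : ℝ × ℝ => F (p.2 + p.1)) 2 (volume.restrict (Q k T)) := by
  simpa only [add_comm] using
    memLp_comp_fst_Q (k := k) (T := T) hF measurePreserving_charRight_symm fun _ => rfl

/-! ### Reflection of characteristics at the moving end -/

/-- The characteristic through `(0, t)`, followed backward in time and reflected at the moving
end, returns to `x = 0` at the time `reflect k t`. -/
def reflect (k t : ℝ) : ℝ := (1 - k) / (1 + k) * (t - 1) - 1

lemma reflect_le_neg_one {k t : ℝ} (hk0 : 0 < k) (hk1 : k < 1) (ht : t ≤ 1) :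
    reflect k t ≤ -1 := by
  have : 0 < (1 - k) / (1 + k) := by apply div_pos <;> linarith
  unfold reflect; nlinarith

lemma reflect_le_sub {k t : ℝ} (hk0 : 0 < k) (ht : 1 ≤ t) : reflect k t ≤ t - 2 := by
  have : (1 - k) / (1 + k) ≤ 1 := by rw [div_le_one (by linarith)]; linarith
  unfold reflect; nlinarith

lemma reflect_nonpos {k t : ℝ} (hk0 : 0 < k) (hk1 : k < 1) (ht : t ≤ 0) : reflect k t ≤ 0 := by
  linarith [reflect_le_neg_one hk0 hk1 (t := t) (by linarith)]

lemma reflect_iterate_nonpos_of_nonpos {k t : ℝ} (hk0 : 0 < k) (hk1 : k < 1) (n : ℕ)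
    (ht : t ≤ 0) : (reflect k)^[n] t ≤ 0 := by
  induction n generalizing t with
  | zero => simpa
  | succ n ih => rw [Function.iterate_succ_apply]; exact ih (reflect_nonpos hk0 hk1 ht)

/-- Each reflection lowers `t` by at least 2 if `t ≥ 1` and sends it below `-1` otherwise, so a
signal present before time `n` has been reflected fewer than `n` times. -/
lemma reflect_iterate_nonpos {k t : ℝ} (hk0 : 0 < k) (hk1 : k < 1) (n : ℕ) (ht : t ≤ n) :
    (reflect k)^[n] t ≤ 0 := by
  induction n generalizing t with
  | zero => simpa using ht
  | succ n ih =>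
    rw [Function.iterate_succ_apply]
    apply ih
    push_cast at ht
    rcases le_total 1 t with h | h
    · linarith [reflect_le_sub hk0 h]
    · have := reflect_le_neg_one hk0 hk1 h
      have : (0 : ℝ) ≤ n := n.cast_nonneg
      linarith

lemma memLp_comp_reflect {k : ℝ} (hk0 : 0 < k) (hk1 : k < 1) {F : ℝ → ℝ} (hF : MemLp F 2) :
    MemLp (fun t => F (reflect k t)) 2 := by
  have hc : (1 - k) / (1 + k) ≠ 0 := (div_pos (by linarith) (by linarith)).ne'
  convert memLp_comp_affine hF hc (-((1 - k) / (1 + k)) - 1) using 3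
  unfold reflect; ring

/-- The equation `F - F ∘ reflect k = w` is solved by the Neumann series over successive reflections
of `w` extended by zero. Finitely many terms suffice up to time `T`, and the difference telescopes.
-/
lemma exists_profile {k T : ℝ} (hk0 : 0 < k) (hk1 : k < 1) (w : Control T) :
    ∃ F : ℝ → ℝ, MemLp F 2 ∧ (∀ t ≤ 0, F t = 0) ∧
      ∀ t ∈ Ioo 0 T, w t = F t - F (reflect k t) := by
  set W : ℝ → ℝ := (Ioo 0 T).indicator w with hW
  have hWm : MemLp W 2 := (memLp_indicator_iff_restrict measurableSet_Ioo).2 (Lp.memLp w)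
  have hW0 : ∀ t ≤ 0, W t = 0 := fun t ht =>
    indicator_of_notMem (fun h => (not_lt.2 ht) h.1) _
  obtain ⟨N, hN⟩ := exists_nat_ge T
  refine ⟨fun t => ∑ j ∈ Finset.range N, W ((reflect k)^[j] t), ?_, ?_, ?_⟩
  · refine memLp_finsetSum (Finset.range N) fun j hj => ?_
    clear hj
    induction j with
    | zero => simpa using hWm
    | succ j ih =>
      simpa only [Function.iterate_succ_apply] using memLp_comp_reflect hk0 hk1 ih
  · intro t ht
    exact Finset.sum_eq_zero fun j _ => hW0 _ (reflect_iterate_nonpos_of_nonpos hk0 hk1 j ht)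
  · intro t ht
    simp only [← Function.iterate_succ_apply]
    rw [← Finset.sum_sub_distrib, Finset.sum_range_sub',
      hW0 _ (reflect_iterate_nonpos hk0 hk1 N (ht.2.le.trans hN))]
    simp [hW, ht]

/-! ### Calculus of test functions -/

section Calculus

variable {θ : ℝ × ℝ → ℝ}

lemma hasDerivAt_comp_curve (hθ : ContDiff ℝ 2 θ) {γ : ℝ → ℝ × ℝ} {v : ℝ × ℝ} {t : ℝ}
    (hγ : HasDerivAt γ v t) : HasDerivAt (fun s => θ (γ s)) (fderiv ℝ θ (γ t) v) t :=
  ((hθ.differentiable (by norm_num)) (γ t)).hasFDerivAt.comp_hasDerivAt t hγ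

lemma hasDerivAt_fderiv_comp_curve (hθ : ContDiff ℝ 2 θ) {γ : ℝ → ℝ × ℝ} {v : ℝ × ℝ} {t : ℝ}
    (hγ : HasDerivAt γ v t) (w : ℝ × ℝ) :
    HasDerivAt (fun s => fderiv ℝ θ (γ s) w) (fderiv ℝ (fderiv ℝ θ) (γ t) v w) t := by
  have h1 : ContDiff ℝ 1 (fderiv ℝ θ) := hθ.fderiv_right (by norm_num)
  have h2 := ((h1.differentiable (by norm_num)) (γ t)).hasFDerivAt.comp_hasDerivAt t hγ
  exact ((ContinuousLinearMap.apply ℝ ℝ w).hasFDerivAt.comp_hasDerivAt t h2)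

lemma hasDerivAt_mk_left (t x : ℝ) : HasDerivAt (fun y : ℝ => (y, t)) ((1 : ℝ), (0 : ℝ)) x :=
  (hasDerivAt_id x).prodMk (hasDerivAt_const x t)

lemma hasDerivAt_mk_right (x t : ℝ) : HasDerivAt (fun s : ℝ => (x, s)) ((0 : ℝ), (1 : ℝ)) t :=
  (hasDerivAt_const t x).prodMk (hasDerivAt_id t)

lemma box_eq (hθ : ContDiff ℝ 2 θ) (p : ℝ × ℝ) :
    box θ p = fderiv ℝ (fderiv ℝ θ) p (0, 1) (0, 1) - fderiv ℝ (fderiv ℝ θ) p (1, 0) (1, 0) := by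
  have h1 : deriv (fun s => θ (p.1, s)) = fun s => fderiv ℝ θ (p.1, s) (0, 1) := by
    ext s; exact (hasDerivAt_comp_curve hθ (hasDerivAt_mk_right p.1 s)).deriv
  have h2 : deriv (fun y => θ (y, p.2)) = fun y => fderiv ℝ θ (y, p.2) (1, 0) := by
    ext s; exact (hasDerivAt_comp_curve hθ (hasDerivAt_mk_left p.2 s)).deriv
  simp only [box, iteratedDeriv_succ, iteratedDeriv_zero]
  rw [h1, h2,
    (hasDerivAt_fderiv_comp_curve hθ (hasDerivAt_mk_right p.1 p.2) (0, 1)).deriv,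
    (hasDerivAt_fderiv_comp_curve hθ (hasDerivAt_mk_left p.2 p.1) (1, 0)).deriv]

lemma continuous_box (hθ : ContDiff ℝ 2 θ) : Continuous (box θ) := by
  have h1 : ContDiff ℝ 1 (fderiv ℝ θ) := hθ.fderiv_right (by norm_num)
  have h2 : Continuous (fderiv ℝ (fderiv ℝ θ)) := h1.continuous_fderiv (by norm_num)
  rw [funext (box_eq hθ)]
  fun_prop

lemma continuous_fderiv_apply (hθ : ContDiff ℝ 2 θ) (w : ℝ × ℝ) :
    Continuous fun p => fderiv ℝ θ p w := by
  have h1 : Continuous (fderiv ℝ θ) := hθ.continuous_fderiv (by norm_num)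
  fun_prop

lemma fderiv_fderiv_symm (hθ : ContDiff ℝ 2 θ) (p v w : ℝ × ℝ) :
    fderiv ℝ (fderiv ℝ θ) p v w = fderiv ℝ (fderiv ℝ θ) p w v :=
  (hθ.contDiffAt.isSymmSndFDerivAt (by simp)) v w

/-- The factorization `∂ₜ² - ∂ₓ² = (∂ₜ + ∂ₓ)(∂ₜ - ∂ₓ)`: along one family of characteristics, the
d'Alembertian is the derivative of the derivative transversal to it. -/
lemma fderiv_fderiv_left (hθ : ContDiff ℝ 2 θ) (p : ℝ × ℝ) :
    fderiv ℝ (fderiv ℝ θ) p (1, 1) (-1, 1) = box θ p := by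
  have e1 : ((1 : ℝ), (1 : ℝ)) = (1, 0) + (0, 1) := by simp
  have e2 : ((-1 : ℝ), (1 : ℝ)) = (0, 1) - (1, 0) := by simp
  rw [box_eq hθ, e1, e2]
  simp only [map_add, map_sub, add_apply]
  rw [fderiv_fderiv_symm hθ p (0, 1) (1, 0)]
  ring

lemma fderiv_fderiv_right (hθ : ContDiff ℝ 2 θ) (p : ℝ × ℝ) :
    fderiv ℝ (fderiv ℝ θ) p (-1, 1) (1, 1) = box θ p := by
  rw [fderiv_fderiv_symm hθ, fderiv_fderiv_left hθ]

lemma hasDerivAt_charLeft (hθ : ContDiff ℝ 2 θ) (ξ t : ℝ) :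
    HasDerivAt (fun s => fderiv ℝ θ (s - ξ, s) (-1, 1)) (box θ (t - ξ, t)) t := by
  rw [← fderiv_fderiv_left hθ]
  exact hasDerivAt_fderiv_comp_curve hθ
    (((hasDerivAt_id t).sub_const ξ).prodMk (hasDerivAt_id t)) _

lemma hasDerivAt_charRight (hθ : ContDiff ℝ 2 θ) (η t : ℝ) :
    HasDerivAt (fun s => fderiv ℝ θ (η - s, s) (1, 1)) (box θ (η - t, t)) t := by
  rw [← fderiv_fderiv_right hθ]
  exact hasDerivAt_fderiv_comp_curve hθ
    (((hasDerivAt_id t).const_sub η).prodMk (hasDerivAt_id t)) _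

lemma integral_charLeft_box (hθ : ContDiff ℝ 2 θ) (ξ a b : ℝ) :
    ∫ t in a..b, box θ (t - ξ, t) =
      fderiv ℝ θ (b - ξ, b) (-1, 1) - fderiv ℝ θ (a - ξ, a) (-1, 1) := by
  refine intervalIntegral.integral_eq_sub_of_hasDerivAt
    (fun t _ => hasDerivAt_charLeft hθ ξ t) (Continuous.intervalIntegrable ?_ _ _)
  have := continuous_box hθ
  fun_prop

lemma integral_charRight_box (hθ : ContDiff ℝ 2 θ) (η a b : ℝ) :
    ∫ t in a..b, box θ (η - t, t) =
      fderiv ℝ θ (η - b, b) (1, 1) - fderiv ℝ θ (η - a, a) (1, 1) := by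
  refine intervalIntegral.integral_eq_sub_of_hasDerivAt
    (fun t _ => hasDerivAt_charRight hθ η t) (Continuous.intervalIntegrable ?_ _ _)
  have := continuous_box hθ
  fun_prop

lemma fderiv_eq_zero_of_curve (hθ : ContDiff ℝ 2 θ) {γ : ℝ → ℝ × ℝ} {v : ℝ × ℝ} {a b t : ℝ}
    (hab : a < b) (ht : t ∈ Icc a b) (hγ : HasDerivAt γ v t) (h0 : ∀ s ∈ Icc a b, θ (γ s) = 0) :
    fderiv ℝ θ (γ t) v = 0 := by
  have h1 := (hasDerivAt_comp_curve hθ hγ).hasDerivWithinAt (s := Icc a b)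
  have h2 : HasDerivWithinAt (fun s => θ (γ s)) 0 (Icc a b) t :=
    (hasDerivWithinAt_const t (Icc a b) (0 : ℝ)).congr h0 (h0 t ht)
  exact (uniqueDiffOn_Icc hab t ht).eq_deriv _ h1 h2

lemma fderiv_mk (p : ℝ × ℝ) (a b : ℝ) :
    fderiv ℝ θ p (a, b) = a * fderiv ℝ θ p (1, 0) + b * fderiv ℝ θ p (0, 1) := by
  have : (a, b) = a • ((1 : ℝ), (0 : ℝ)) + b • ((0 : ℝ), (1 : ℝ)) := by simp
  rw [this, map_add, map_smul, map_smul, smul_eq_mul, smul_eq_mul]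

end Calculus

/-! ### Gradients of test functions on the boundary -/

namespace IsTest

variable {k T : ℝ} {θ : ℝ × ℝ → ℝ}

lemma fderiv_left (hθ : IsTest k T θ) (hT : 0 < T) {t : ℝ} (ht : t ∈ Icc 0 T) :
    fderiv ℝ θ (0, t) (0, 1) = 0 :=
  fderiv_eq_zero_of_curve (γ := fun s => (0, s)) hθ.smooth hT ht (hasDerivAt_mk_right 0 t) hθ.left

lemma fderiv_right (hθ : IsTest k T θ) (hT : 0 < T) {t : ℝ} (ht : t ∈ Icc 0 T) :
    k * fderiv ℝ θ (1 + k * t, t) (1, 0) + fderiv ℝ θ (1 + k * t, t) (0, 1) = 0 := by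
  have h := fderiv_eq_zero_of_curve (γ := fun s => (1 + k * s, s)) (v := (k, 1)) hθ.smooth hT ht
    (by simpa using (((hasDerivAt_id t).const_mul k).const_add 1).prodMk (hasDerivAt_id t))
    hθ.right
  rw [fderiv_mk] at h
  linarith

lemma fderiv_final_fst (hθ : IsTest k T θ) (hk : 0 < k) (hT : 0 < T) {x : ℝ}
    (hx : x ∈ Icc 0 (1 + k * T)) : fderiv ℝ θ (x, T) (1, 0) = 0 :=
  fderiv_eq_zero_of_curve (γ := fun y => (y, T)) hθ.smooth (by positivity) hx
    (hasDerivAt_mk_left T x) hθ.final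

lemma fderiv_final_snd (hθ : IsTest k T θ) {x : ℝ}
    (hx : x ∈ Icc 0 (1 + k * T)) : fderiv ℝ θ (x, T) (0, 1) = 0 := by
  rw [← (hasDerivAt_comp_curve hθ.smooth (hasDerivAt_mk_right x T)).deriv]
  exact hθ.final_velocity x hx

lemma fderiv_final (hθ : IsTest k T θ) (hk : 0 < k) (hT : 0 < T) {x : ℝ}
    (hx : x ∈ Icc 0 (1 + k * T)) (v : ℝ × ℝ) : fderiv ℝ θ (x, T) v = 0 := by
  rw [← Prod.mk.eta (p := v), fderiv_mk, hθ.fderiv_final_fst hk hT hx, hθ.fderiv_final_snd hx]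
  simp

end IsTest

/-- The normal derivative of `θ` at the moving end, as a function of time, frozen after `T`. -/
def endFlux (k T : ℝ) (θ : ℝ × ℝ → ℝ) (τ : ℝ) : ℝ :=
  fderiv ℝ θ (1 + k * min T τ, min T τ) (1, 0)

/-- Since the gradient of `θ` vanishes at time `T`, freezing the flux there lets one formula cover
characteristics that meet the moving end before `T` and those that do not. -/
lemma endFlux_of_le {k T : ℝ} {θ : ℝ × ℝ → ℝ} (hθ : IsTest k T θ) (hk : 0 < k) (hT : 0 < T)
    {τ : ℝ} (h : T ≤ τ) : endFlux k T θ τ = 0 := by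
  rw [endFlux, min_eq_left h]
  exact hθ.fderiv_final hk hT ⟨by positivity, le_rfl⟩ _

lemma integrable_mul_box {k T : ℝ} {θ : ℝ × ℝ → ℝ} (hθ : ContDiff ℝ 2 θ) (hk : 0 < k)
    {f : ℝ × ℝ → ℝ} (hf : MemLp f 2 (volume.restrict (Q k T))) :
    Integrable (fun p => f p * box θ p) (volume.restrict (Q k T)) :=
  hf.integrable_mul (memLp_continuous_Q hk (continuous_box hθ))

lemma integral_indicator_eq_interval {s : Set ℝ} {a b : ℝ} (hab : a ≤ b) (hs : s = Ioo a b)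
    (g : ℝ → ℝ) : ∫ t, s.indicator g t = ∫ t in a..b, g t := by
  rw [hs, integral_indicator measurableSet_Ioo, intervalIntegral.integral_of_le hab,
    integral_Ioc_eq_integral_Ioo]

/-- The characteristic `x = t - ξ` leaves `x = 0` at time `ξ` and meets the moving end at time `(ξ +
1) / (1 - k)`, unless `T` comes first. Integrating along it leaves `-θ_x + θ'` at the two ends;
there `θ' = 0` and `θ' = -k θ_x` respectively, whence the factor `1 + k`. -/
lemma integral_left_mul_box {k T : ℝ} {θ : ℝ × ℝ → ℝ} (hk0 : 0 < k) (hk1 : k < 1) (hT : 0 < T)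
    (hθ : IsTest k T θ) {F : ℝ → ℝ} (hF : MemLp F 2) (hF0 : ∀ t ≤ 0, F t = 0) :
    ∫ p in Q k T, F (p.2 - p.1) * box θ p =
      ∫ ξ, F ξ * ((Ioo 0 T).indicator (fun s => fderiv ℝ θ (0, s) (1, 0)) ξ -
        (1 + k) * endFlux k T θ ((ξ + 1) / (1 - k))) := by
  have hint := integrable_mul_box (θ := θ) hθ.smooth hk0 (memLp_left_Q (k := k) (T := T) hF)
  rw [← integral_indicator (measurableSet_Q k T),
    integral_charLeft ((integrable_indicator_iff (measurableSet_Q k T)).2 hint)]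
  refine integral_congr_ae (.of_forall fun ξ => ?_)
  dsimp only
  rcases le_or_gt ξ 0 with h0 | h0
  · rw [hF0 ξ h0, zero_mul]
    refine integral_eq_zero_of_ae (.of_forall fun t => ?_)
    simp [indicator, hF0 ξ h0]
  have hk1' : 0 < 1 - k := by linarith
  have key : ∫ t, {t | (t - ξ, t) ∈ Q k T}.indicator (fun t => box θ (t - ξ, t)) t =
      (Ioo 0 T).indicator (fun s => fderiv ℝ θ (0, s) (1, 0)) ξ -
        (1 + k) * endFlux k T θ ((ξ + 1) / (1 - k)) := by
    rcases le_or_gt T ξ with h1 | h1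
    · have hset : {t | (t - ξ, t) ∈ Q k T} = ∅ := by
        ext t
        simp only [Q, Om, mem_Ioo, mem_ofPred_eq, mem_empty_iff_false, iff_false]
        rintro ⟨⟨_, h⟩, h', _⟩
        linarith
      rw [hset, endFlux_of_le hθ hk0 hT]
      · simp [h1]
      · rw [le_div_iff₀ hk1']; nlinarith
    · have hτ : ξ < (ξ + 1) / (1 - k) := by rw [lt_div_iff₀ hk1']; nlinarith
      have hset : {t | (t - ξ, t) ∈ Q k T} = Ioo ξ (min T ((ξ + 1) / (1 - k))) := by
        ext t
        simp only [Q, Om, mem_Ioo, mem_ofPred_eq, lt_min_iff, lt_div_iff₀ hk1']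
        constructor
        · rintro ⟨⟨_, h⟩, h', h''⟩
          refine ⟨by linarith, h, by linarith⟩
        · rintro ⟨h, h', h''⟩
          refine ⟨⟨by linarith, h'⟩, by linarith, by linarith⟩
      rw [integral_indicator_eq_interval (lt_min h1 hτ).le hset, integral_charLeft_box hθ.smooth,
        indicator_of_mem (show ξ ∈ Ioo 0 T from ⟨h0, h1⟩), sub_self, fderiv_mk (0, ξ),
        hθ.fderiv_left hT ⟨h0.le, h1.le⟩]
      have : fderiv ℝ θ (min T ((ξ + 1) / (1 - k)) - ξ, min T ((ξ + 1) / (1 - k))) (-1, 1) =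
          -(1 + k) * endFlux k T θ ((ξ + 1) / (1 - k)) := by
        rcases le_or_gt T ((ξ + 1) / (1 - k)) with h2 | h2
        · rw [endFlux_of_le hθ hk0 hT h2, min_eq_left h2, hθ.fderiv_final hk0 hT]
          · ring
          · rw [le_div_iff₀ hk1'] at h2
            exact ⟨by linarith, by linarith⟩
        · rw [endFlux, min_eq_right h2.le]
          have e : (ξ + 1) / (1 - k) - ξ = 1 + k * ((ξ + 1) / (1 - k)) := by field_simp; ring
          rw [e, fderiv_mk]
          have := hθ.fderiv_right hT (t := (ξ + 1) / (1 - k)) ⟨by linarith, h2.le⟩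
          linarith
      rw [this]; ring
  rw [← key, ← integral_const_mul]
  refine integral_congr_ae (.of_forall fun t => ?_)
  simp [indicator]

/-- The mirror image: `x = η - t` leaves the moving end at time `(η - 1) / (1 + k)` and arrives at
`x = 0` at time `η`. The hypothesis on `G` removes the characteristics that start from the initial
line. -/
lemma integral_right_mul_box {k T : ℝ} {θ : ℝ × ℝ → ℝ} (hk0 : 0 < k) (hk1 : k < 1) (hT : 0 < T)
    (hθ : IsTest k T θ) {G : ℝ → ℝ} (hG : MemLp G 2) (hG0 : ∀ t, reflect k t ≤ 0 → G t = 0) :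
    ∫ p in Q k T, G (p.2 + p.1) * box θ p =
      ∫ η, G η * ((Ioo 0 T).indicator (fun s => fderiv ℝ θ (0, s) (1, 0)) η -
        (1 - k) * endFlux k T θ ((η - 1) / (1 + k))) := by
  have hint := integrable_mul_box (θ := θ) hθ.smooth hk0 (memLp_right_Q (k := k) (T := T) hG)
  rw [← integral_indicator (measurableSet_Q k T),
    integral_charRight ((integrable_indicator_iff (measurableSet_Q k T)).2 hint)]
  refine integral_congr_ae (.of_forall fun η => ?_)
  dsimp only
  rcases le_or_gt (reflect k η) 0 with h0 | h0
  · rw [hG0 η h0, zero_mul]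
    refine integral_eq_zero_of_ae (.of_forall fun t => ?_)
    simp [indicator, hG0 η h0]
  have hk1' : 0 < 1 + k := by linarith
  have hη : 1 < η := by
    by_contra! h
    linarith [reflect_le_neg_one hk0 hk1 h]
  have key : ∫ t, {t | (η - t, t) ∈ Q k T}.indicator (fun t => box θ (η - t, t)) t =
      (Ioo 0 T).indicator (fun s => fderiv ℝ θ (0, s) (1, 0)) η -
        (1 - k) * endFlux k T θ ((η - 1) / (1 + k)) := by
    rcases le_or_gt T ((η - 1) / (1 + k)) with h1 | h1
    · rw [endFlux_of_le hθ hk0 hT h1]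
      rw [le_div_iff₀ hk1'] at h1
      have hset : {t | (η - t, t) ∈ Q k T} = ∅ := by
        ext t
        simp only [Q, Om, mem_Ioo, mem_ofPred_eq, mem_empty_iff_false, iff_false]
        rintro ⟨⟨_, h⟩, _, h'⟩
        nlinarith
      rw [hset, indicator_of_notMem]
      · simp
      · rintro ⟨_, h⟩
        nlinarith
    · have h2 : (η - 1) / (1 + k) < η := by rw [div_lt_iff₀ hk1']; nlinarith
      have h3 : 0 < (η - 1) / (1 + k) := div_pos (by linarith) hk1'
      have hset : {t | (η - t, t) ∈ Q k T} = Ioo ((η - 1) / (1 + k)) (min T η) := by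
        ext t
        simp only [Q, Om, mem_Ioo, mem_ofPred_eq, lt_min_iff, div_lt_iff₀ hk1']
        constructor
        · rintro ⟨⟨_, h⟩, h', h''⟩
          refine ⟨by linarith, h, by linarith⟩
        · rintro ⟨h, h', h''⟩
          refine ⟨⟨?_, h'⟩, by linarith, by linarith⟩
          by_contra! h4
          nlinarith
      rw [integral_indicator_eq_interval (lt_min h1 h2).le hset, integral_charRight_box hθ.smooth]
      have e1 : η - (η - 1) / (1 + k) = 1 + k * ((η - 1) / (1 + k)) := by field_simp; ring
      have e2 : fderiv ℝ θ (η - (η - 1) / (1 + k), (η - 1) / (1 + k)) (1, 1) =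
          (1 - k) * endFlux k T θ ((η - 1) / (1 + k)) := by
        rw [endFlux, min_eq_right h1.le, e1, fderiv_mk]
        have := hθ.fderiv_right hT (t := (η - 1) / (1 + k)) ⟨by linarith, h1.le⟩
        linarith
      have e3 : fderiv ℝ θ (η - min T η, min T η) (1, 1) =
          (Ioo 0 T).indicator (fun s => fderiv ℝ θ (0, s) (1, 0)) η := by
        rcases le_or_gt T η with h4 | h4
        · rw [min_eq_left h4, indicator_of_notMem (fun h => (not_lt.2 h4) h.2),
            hθ.fderiv_final hk0 hT]
          rw [div_lt_iff₀ hk1'] at h1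
          exact ⟨by linarith, by linarith⟩
        · rw [min_eq_right h4.le, indicator_of_mem (show η ∈ Ioo 0 T from ⟨by linarith, h4⟩),
            sub_self, fderiv_mk, hθ.fderiv_left hT ⟨by linarith, h4.le⟩]
          ring
      rw [e2, e3]
  rw [← key, ← integral_const_mul]
  refine integral_congr_ae (.of_forall fun t => ?_)
  simp [indicator]

lemma memLp_flux {T : ℝ} {θ : ℝ × ℝ → ℝ} (hθ : ContDiff ℝ 2 θ) :
    MemLp (fun t => deriv (fun x => θ (x, t)) 0) 2 (volume.restrict (Ioo 0 T)) := by
  have hd : (fun t => deriv (fun x => θ (x, t)) 0) = fun t => fderiv ℝ θ (0, t) (1, 0) :=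
    funext fun t => (hasDerivAt_comp_curve hθ (hasDerivAt_mk_left t 0)).deriv
  have hc : Continuous fun s : ℝ => fderiv ℝ θ (0, s) (1, 0) :=
    (continuous_fderiv_apply hθ (1, 0)).comp (by fun_prop)
  rw [hd]
  obtain ⟨C, hC⟩ := (isCompact_Icc (a := (0 : ℝ)) (b := T)).exists_bound_of_continuousOn
    hc.continuousOn
  exact MemLp.of_bound hc.aestronglyMeasurable C
    ((ae_restrict_iff' measurableSet_Ioo).2 (.of_forall fun p hp => hC p (Ioo_subset_Icc_self hp)))

/-- The d'Alembert formula yields a solution in the sense of transposition. -/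
lemma transposition_identity {k T : ℝ} {θ : ℝ × ℝ → ℝ} (hk0 : 0 < k) (hk1 : k < 1) (hT : 0 < T)
    (hθ : IsTest k T θ) {F : ℝ → ℝ} (hF : MemLp F 2) (hF0 : ∀ t ≤ 0, F t = 0) :
    ∫ p in Q k T, (F (p.2 - p.1) - F (reflect k (p.2 + p.1))) * box θ p =
      ∫ t in Ioo 0 T, (F t - F (reflect k t)) * deriv (fun x => θ (x, t)) 0 := by
  have hG := memLp_comp_reflect hk0 hk1 hF
  have i1 := integrable_mul_box hθ.smooth hk0 (memLp_left_Q (k := k) (T := T) hF)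
  have i2 := integrable_mul_box hθ.smooth hk0 (memLp_right_Q (k := k) (T := T) hG)
  simp only [sub_mul]
  rw [integral_sub i1 i2, integral_left_mul_box hk0 hk1 hT hθ hF hF0,
    integral_right_mul_box hk0 hk1 hT hθ hG fun t ht => hF0 _ ht]
  have hd : ∀ t, deriv (fun x => θ (x, t)) 0 = fderiv ℝ θ (0, t) (1, 0) := fun t =>
    (hasDerivAt_comp_curve hθ.smooth (hasDerivAt_mk_left t 0)).deriv
  simp only [hd]
  set D : ℝ → ℝ := (Ioo 0 T).indicator (fun s => fderiv ℝ θ (0, s) (1, 0)) with hD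
  have hflux : MemLp (fun s => fderiv ℝ θ (0, s) (1, 0)) 2 (volume.restrict (Ioo 0 T)) := by
    simpa only [hd] using memLp_flux (T := T) hθ.smooth
  have hDm : MemLp D 2 := (memLp_indicator_iff_restrict measurableSet_Ioo).2 hflux
  have j1 : Integrable (fun t => F t * D t) := hF.integrable_mul hDm
  have j2 : Integrable (fun t => F (reflect k t) * D t) := hG.integrable_mul hDm
  set m : ℝ → ℝ := fun ξ => F ξ * endFlux k T θ ((ξ + 1) / (1 - k)) with hm
  have j3 : Integrable m := by
    have hc : Continuous fun ξ : ℝ => endFlux k T θ ((ξ + 1) / (1 - k)) := by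
      unfold endFlux
      exact (continuous_fderiv_apply hθ.smooth (1, 0)).comp (by fun_prop)
    -- `F` vanishes before 0 and the flux vanishes for `ξ ≥ T`, so restricting the flux to `[0, T]`
    -- does not change the product.
    have hmem : MemLp ((Icc 0 T).indicator fun ξ : ℝ => endFlux k T θ ((ξ + 1) / (1 - k))) 2 := by
      obtain ⟨C, hC⟩ := (isCompact_Icc (a := (0 : ℝ)) (b := T)).exists_bound_of_continuousOn
        hc.continuousOn
      refine (memLp_indicator_iff_restrict measurableSet_Icc).2
        (MemLp.of_bound hc.aestronglyMeasurable C
          ((ae_restrict_iff' measurableSet_Icc).2 (.of_forall fun p hp => hC p hp)))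
    refine (hF.integrable_mul hmem).congr (.of_forall fun ξ => ?_)
    by_cases h : ξ ∈ Icc 0 T
    · simp [hm, h]
    · simp only [hm, Pi.mul_apply, indicator_of_notMem h, mul_zero]
      rcases le_or_gt ξ 0 with h0 | h0
      · simp [hF0 ξ h0]
      · have h1 : T < ξ := by
          by_contra! h1
          exact h ⟨h0.le, h1⟩
        rw [endFlux_of_le hθ hk0 hT, mul_zero]
        rw [le_div_iff₀ (by linarith)]; nlinarith
  have hτ : ∀ η, F (reflect k η) * endFlux k T θ ((η - 1) / (1 + k)) = m (reflect k η) := by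
    intro η
    have : (reflect k η + 1) / (1 - k) = (η - 1) / (1 + k) := by
      have : 1 - k ≠ 0 := by linarith
      have : 1 + k ≠ 0 := by linarith
      unfold reflect; field_simp; ring
    simp only [hm, this]
  have hc : 0 < (1 - k) / (1 + k) := div_pos (by linarith) (by linarith)
  have j4 : Integrable fun η => m (reflect k η) := by
    have := (j3.comp_sub_right 1).comp_sub_right ((1 - k) / (1 + k)) |>.comp_mul_left' hc.ne'
    convert this using 3
    unfold reflect; ring
  -- The slope of the reflection is `(1 - k) / (1 + k)`. This is exactly the ratio of the factors `1
  -- - k` and `1 + k` of the two flux terms, so the contributions of the moving end cancel.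
  have hsub : ∫ η, m (reflect k η) = (1 + k) / (1 - k) * ∫ ξ, m ξ := by
    have e : (fun η => m (reflect k η)) = fun η =>
        (fun y => m (y - ((1 - k) / (1 + k) + 1))) ((1 - k) / (1 + k) * η) := by
      ext η; congr 1; unfold reflect; ring
    rw [e, Measure.integral_comp_mul_left (fun y => m (y - ((1 - k) / (1 + k) + 1))),
      integral_sub_right_eq_self m, inv_div,
      abs_of_pos (div_pos (by linarith) (by linarith)), smul_eq_mul]
  have l1 : ∫ ξ, F ξ * (D ξ - (1 + k) * endFlux k T θ ((ξ + 1) / (1 - k))) =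
      (∫ t, F t * D t) - (1 + k) * ∫ ξ, m ξ := by
    rw [← integral_const_mul, ← integral_sub j1 (j3.const_mul _)]
    congr 1; ext ξ; simp only [hm]; ring
  have l2 : ∫ η, F (reflect k η) * (D η - (1 - k) * endFlux k T θ ((η - 1) / (1 + k))) =
      (∫ t, F (reflect k t) * D t) - (1 - k) * ∫ η, m (reflect k η) := by
    rw [← integral_const_mul, ← integral_sub j2 (j4.const_mul _)]
    congr 1; ext ξ; rw [← hτ]; ring
  have l3 : ∫ t in Ioo 0 T, (F t * fderiv ℝ θ (0, t) (1, 0) -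
      F (reflect k t) * fderiv ℝ θ (0, t) (1, 0)) =
      (∫ t, F t * D t) - ∫ t, F (reflect k t) * D t := by
    rw [← integral_sub j1 j2, ← integral_indicator measurableSet_Ioo]
    congr 1; ext t
    by_cases h : t ∈ Ioo 0 T <;> simp [hD, h]
  rw [l1, l2, l3, hsub]
  have : 1 - k ≠ 0 := by linarith
  field_simp
  ring

/-! ### Products of test functions are total -/

lemma ae_eq_zero_of_forall_rectangle {W : ℝ × ℝ → ℝ} (hW : Integrable W)
    (h : ∀ s t : Set ℝ, MeasurableSet s → MeasurableSet t → ∫ p in s ×ˢ t, W p = 0) :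
    W =ᵐ[volume] 0 := by
  refine hW.ae_eq_zero_of_forall_setIntegral_eq_zero fun A hA hA' => ?_
  clear hA'
  induction A, hA using MeasurableSpace.induction_on_inter generateFrom_prod.symm isPiSystem_prod
    with
  | empty => simp
  | basic A hA =>
    obtain ⟨s, hs, t, ht, rfl⟩ := hA
    exact h s t hs ht
  | compl A hA ih =>
    have h1 := integral_add_compl hA hW
    have h2 := h univ univ .univ .univ
    rw [univ_prod_univ, setIntegral_univ] at h2
    rw [ih, h2, zero_add] at h1
    exact h1
  | iUnion f hf hm ih =>
    rw [integral_iUnion hm hf hW.integrableOn]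
    simp [ih]

lemma integrable_mul_left_of_continuous {W : ℝ × ℝ → ℝ} (hW : Integrable W) {b : ℝ × ℝ → ℝ}
    (hb : Measurable b) {C : ℝ} (hC : ∀ p, ‖b p‖ ≤ C) :
    Integrable fun p : ℝ × ℝ => b p * W p :=
  hW.bdd_mul hb.aestronglyMeasurable (.of_forall hC)

/-- The fundamental lemma is applied in one variable at a time. The null set of `x` obtained first
depends on `b`; integrating in `x` over an arbitrary measurable set before varying `b` disposes of
this dependence and leaves only rectangles. -/
lemma ae_eq_zero_of_forall_product_test {I J : Set ℝ} (hI : IsOpen I) (hJ : IsOpen J)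
    {W : ℝ × ℝ → ℝ} (hW : Integrable W) (hW0 : ∀ p, p ∉ I ×ˢ J → W p = 0)
    (h : ∀ a b : ℝ → ℝ, ContDiff ℝ ∞ a → HasCompactSupport a → tsupport a ⊆ I →
      ContDiff ℝ ∞ b → HasCompactSupport b → tsupport b ⊆ J →
      ∫ p, a p.1 * (b p.2 * W p) = 0) : W =ᵐ[volume] 0 := by
  have step1 : ∀ b : ℝ → ℝ, ContDiff ℝ ∞ b → HasCompactSupport b → tsupport b ⊆ J →
      ∀ᵐ x, ∫ y, b y * W (x, y) = 0 := by
    intro b hb1 hb2 hb3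
    obtain ⟨C, hC⟩ := hb2.exists_bound_of_continuous hb1.continuous
    have hbW : Integrable fun p : ℝ × ℝ => b p.2 * W p :=
      integrable_mul_left_of_continuous hW (hb1.continuous.measurable.comp measurable_snd)
        fun p => hC p.2
    have := hI.ae_eq_zero_of_integral_contDiff_smul_eq_zero
      (f := fun x => ∫ y, b y * W (x, y)) (μ := volume)
      ((show Integrable fun x => ∫ y, b y * W (x, y) from
        hbW.integral_prod_left).locallyIntegrable.locallyIntegrableOn I) ?_
    · filter_upwards [this] with x hx
      by_cases hxI : x ∈ I
      · exact hx hxI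
      · refine integral_eq_zero_of_ae (.of_forall fun y => ?_)
        simp [hW0 (x, y) fun hp => hxI hp.1]
    · intro a ha1 ha2 ha3
      obtain ⟨D, hD⟩ := ha2.exists_bound_of_continuous ha1.continuous
      have hi : Integrable fun p : ℝ × ℝ => a p.1 * (b p.2 * W p) :=
        integrable_mul_left_of_continuous hbW (ha1.continuous.measurable.comp measurable_fst)
          fun p => hD p.1
      rw [← h a b ha1 ha2 ha3 hb1 hb2 hb3, Measure.volume_eq_prod, integral_prod _ hi]
      simp [integral_const_mul]
  have step2 : ∀ s : Set ℝ, MeasurableSet s → ∀ᵐ y, ∫ x, s.indicator 1 x * W (x, y) = 0 := by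
    intro s hs
    have hsm : Measurable fun p : ℝ × ℝ => s.indicator (1 : ℝ → ℝ) p.1 :=
      (measurable_one.indicator hs).comp measurable_fst
    have hs1 : ∀ p : ℝ × ℝ, ‖s.indicator (1 : ℝ → ℝ) p.1‖ ≤ 1 := fun p => by
      by_cases hp : p.1 ∈ s <;> simp [hp]
    have hsW : Integrable fun p : ℝ × ℝ => s.indicator 1 p.1 * W p :=
      integrable_mul_left_of_continuous hW hsm hs1
    have := hJ.ae_eq_zero_of_integral_contDiff_smul_eq_zero
      (f := fun y => ∫ x, s.indicator 1 x * W (x, y)) (μ := volume)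
      ((show Integrable fun y => ∫ x, s.indicator 1 x * W (x, y) from
        hsW.integral_prod_right).locallyIntegrable.locallyIntegrableOn J) ?_
    · filter_upwards [this] with y hy
      by_cases hyJ : y ∈ J
      · exact hy hyJ
      · refine integral_eq_zero_of_ae (.of_forall fun x => ?_)
        simp [hW0 (x, y) fun hp => hyJ hp.2]
    · intro b hb1 hb2 hb3
      obtain ⟨C, hC⟩ := hb2.exists_bound_of_continuous hb1.continuous
      have hbW : Integrable fun p : ℝ × ℝ => b p.2 * W p :=
        integrable_mul_left_of_continuous hW (hb1.continuous.measurable.comp measurable_snd)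
          fun p => hC p.2
      have hi : Integrable fun p : ℝ × ℝ => s.indicator 1 p.1 * (b p.2 * W p) :=
        integrable_mul_left_of_continuous hbW hsm hs1
      have e1 : ∫ y, b y • ∫ x, s.indicator 1 x * W (x, y) =
          ∫ y, ∫ x, s.indicator 1 x * (b y * W (x, y)) := by
        congr 1; ext y
        rw [smul_eq_mul, ← integral_const_mul]
        congr 1; ext x; ring
      rw [e1, ← integral_integral_swap (f := fun x y => s.indicator 1 x * (b y * W (x, y))) hi]
      refine integral_eq_zero_of_ae ?_
      filter_upwards [step1 b hb1 hb2 hb3] with x hx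
      rw [integral_const_mul, hx, mul_zero]; rfl
  refine ae_eq_zero_of_forall_rectangle hW fun s t hs ht => ?_
  rw [← integral_indicator (hs.prod ht), Measure.volume_eq_prod,
    integral_prod_symm _ (hW.indicator (hs.prod ht))]
  refine integral_eq_zero_of_ae ?_
  filter_upwards [step2 s hs] with y hy
  by_cases hyt : y ∈ t
  · rw [Pi.zero_apply, ← hy]
    congr 1; ext x
    by_cases hx : x ∈ s <;> simp [indicator, hx, hyt]
  · refine integral_eq_zero_of_ae (.of_forall fun x => ?_)
    simp [indicator, hyt]

/-! ### Construction of test functions -/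

/-- The inverse of `reflect k`. -/
def unreflect (k ξ : ℝ) : ℝ := 1 + (1 + k) * ((ξ + 1) / (1 - k))

/-- The source of the functional equation for the reflected part of a test function. -/
def reflSource (k : ℝ) (A B : ℝ → ℝ) (ξ : ℝ) : ℝ :=
  A (unreflect k ξ) * B (unreflect k ξ) - A ξ * B (unreflect k ξ)

/-- The reflected part of a test function. -/
def reflPart (k : ℝ) (A B : ℝ → ℝ) (N : ℕ) (ξ : ℝ) : ℝ :=
  ∑ n ∈ Finset.range N, reflSource k A B ((unreflect k)^[n] ξ)

/-- A test function with source `4 A'(t - x) B'(t + x)`. -/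
def productTest (k : ℝ) (A B : ℝ → ℝ) (N : ℕ) (p : ℝ × ℝ) : ℝ :=
  A (p.2 - p.1) * B (p.2 + p.1) + reflPart k A B N (p.2 - p.1) -
    (A (p.2 + p.1) * B (p.2 + p.1) + reflPart k A B N (p.2 + p.1))

section ProductTest

variable {k t₁ : ℝ} {A B : ℝ → ℝ}

lemma unreflect_ge {ξ : ℝ} (hk0 : 0 < k) (hk1 : k < 1) (hξ : -1 ≤ ξ) :
    1 + (1 + k) * (ξ + 1) ≤ unreflect k ξ := by
  have : ξ + 1 ≤ (ξ + 1) / (1 - k) := by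
    rw [le_div_iff₀ (by linarith)]; nlinarith
  unfold unreflect
  nlinarith

lemma add_two_le_unreflect {ξ : ℝ} (hk0 : 0 < k) (hk1 : k < 1) (hξ : -1 ≤ ξ) :
    ξ + 2 ≤ unreflect k ξ := by
  have := unreflect_ge hk0 hk1 hξ
  nlinarith

lemma add_le_unreflect_iterate {ξ : ℝ} (hk0 : 0 < k) (hk1 : k < 1) (hξ : -1 ≤ ξ) (n : ℕ) :
    ξ + 2 * n ≤ (unreflect k)^[n] ξ := by
  induction n generalizing ξ with
  | zero => simp
  | succ n ih =>
    rw [Function.iterate_succ_apply]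
    have h1 := add_two_le_unreflect hk0 hk1 hξ
    have := ih (ξ := unreflect k ξ) (by linarith)
    push_cast; linarith

lemma contDiff_unreflect (k : ℝ) : ContDiff ℝ 2 (unreflect k) := by
  unfold unreflect; fun_prop

lemma contDiff_reflSource (hA : ContDiff ℝ 2 A) (hB : ContDiff ℝ 2 B) :
    ContDiff ℝ 2 (reflSource k A B) := by
  have := contDiff_unreflect k
  unfold reflSource
  fun_prop

lemma contDiff_reflPart (hA : ContDiff ℝ 2 A) (hB : ContDiff ℝ 2 B) (N : ℕ) :
    ContDiff ℝ 2 (reflPart k A B N) := by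
  refine ContDiff.sum fun n hn => (contDiff_reflSource hA hB).comp ?_
  clear hn
  induction n with
  | zero => exact contDiff_id
  | succ n ih =>
    rw [Function.iterate_succ]
    exact ih.comp (contDiff_unreflect k)

lemma contDiff_productTest (hA : ContDiff ℝ 2 A) (hB : ContDiff ℝ 2 B) (N : ℕ) :
    ContDiff ℝ 2 (productTest k A B N) := by
  have := contDiff_reflPart (k := k) hA hB N
  unfold productTest
  fun_prop

/-- The characteristic `ξ` meets the moving end at time `(ξ + 1) / (1 - k)`, the half sum of `ξ` and
`unreflect k ξ`. After `t₁` the product `A B` is already zero there. -/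
lemma reflSource_eq_zero (hk0 : 0 < k) (hk1 : k < 1)
    (hAB : ∀ ξ η, 2 * t₁ ≤ ξ + η → A ξ * B η = 0) {ξ : ℝ} (h1 : -1 ≤ ξ)
    (h2 : (1 - k) * t₁ ≤ ξ + 1) : reflSource k A B ξ = 0 := by
  have h3 : 0 ≤ (ξ + 1) / (1 - k) := div_nonneg (by linarith) (by linarith)
  have h4 : t₁ ≤ (ξ + 1) / (1 - k) := by rw [le_div_iff₀ (by linarith)]; linarith
  have h5 : t₁ ≤ unreflect k ξ := by unfold unreflect; nlinarith
  have h6 : ξ + unreflect k ξ = 2 * ((ξ + 1) / (1 - k)) := by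
    have : 1 - k ≠ 0 := by linarith
    unfold unreflect; field_simp; ring
  rw [reflSource, hAB _ _ (by linarith), hAB _ _ (by linarith), sub_zero]

lemma reflPart_eq_zero (hk0 : 0 < k) (hk1 : k < 1)
    (hAB : ∀ ξ η, 2 * t₁ ≤ ξ + η → A ξ * B η = 0) (N : ℕ) {ξ : ℝ} (h1 : -1 ≤ ξ)
    (h2 : (1 - k) * t₁ ≤ ξ + 1) : reflPart k A B N ξ = 0 := by
  refine Finset.sum_eq_zero fun n _ => ?_
  have h3 := add_le_unreflect_iterate hk0 hk1 h1 n
  have h4 : (0 : ℝ) ≤ n := n.cast_nonneg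
  exact reflSource_eq_zero hk0 hk1 hAB (by linarith) (by linarith)

/-- This is the condition that `productTest` vanish at the moving end. The series runs forward in
time, where the source dies out, because the test function must vanish at the final time;
telescoping leaves only the `N`-th iterate. -/
lemma reflPart_functional_equation (hk0 : 0 < k) (hk1 : k < 1)
    (hAB : ∀ ξ η, 2 * t₁ ≤ ξ + η → A ξ * B η = 0) {N : ℕ} (hN : t₁ ≤ N) (ht : 0 ≤ t₁)
    {ξ : ℝ} (h1 : -1 ≤ ξ) :
    reflPart k A B N ξ - reflPart k A B N (unreflect k ξ) = reflSource k A B ξ := by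
  simp only [reflPart, ← Function.iterate_succ_apply]
  rw [← Finset.sum_sub_distrib, Finset.sum_range_sub', Function.iterate_zero, id,
    reflSource_eq_zero (ξ := (unreflect k)^[N] ξ) hk0 hk1 hAB, sub_zero]
  · have := add_le_unreflect_iterate hk0 hk1 h1 N
    linarith
  · have := add_le_unreflect_iterate hk0 hk1 h1 N
    nlinarith

lemma productTest_eq_zero (hk0 : 0 < k) (hk1 : k < 1)
    (hAB : ∀ ξ η, 2 * t₁ ≤ ξ + η → A ξ * B η = 0) (N : ℕ) {x t : ℝ} (hx : 0 ≤ x)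
    (h0 : t₁ ≤ t) (h1 : -1 ≤ t - x) (h2 : (1 - k) * t₁ ≤ t - x + 1) :
    productTest k A B N (x, t) = 0 := by
  simp only [productTest]
  rw [hAB _ _ (by linarith), hAB _ _ (by linarith),
    reflPart_eq_zero hk0 hk1 hAB N h1 h2,
    reflPart_eq_zero hk0 hk1 hAB N (by linarith) (by linarith)]
  simp

lemma isTest_productTest {T : ℝ} (hk0 : 0 < k) (hk1 : k < 1) (hA : ContDiff ℝ 2 A)
    (hB : ContDiff ℝ 2 B) (hAB : ∀ ξ η, 2 * t₁ ≤ ξ + η → A ξ * B η = 0) (ht : 0 ≤ t₁)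
    (htT : t₁ < T) {N : ℕ} (hN : t₁ ≤ N) : IsTest k T (productTest k A B N) := by
  -- Vanishing for all `t` near `T`, rather than only at `T`, gives both final conditions at once.
  have hev : ∀ x ∈ Icc 0 (1 + k * T), ∀ᶠ t in 𝓝 T, productTest k A B N (x, t) = 0 := by
    intro x hx
    have hTk : (1 - k) * t₁ < (1 - k) * T := mul_lt_mul_of_pos_left htT (by linarith)
    have hTk0 : 0 ≤ (1 - k) * t₁ := mul_nonneg (by linarith) ht
    filter_upwards [lt_mem_nhds htT, lt_mem_nhds (show x - 1 + (1 - k) * t₁ < T by linarith [hx.2])]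
      with t h1 h2
    exact productTest_eq_zero hk0 hk1 hAB N hx.1 h1.le (by linarith) (by linarith)
  refine ⟨contDiff_productTest hA hB N, fun t _ => ?_, fun t ht' => ?_,
    fun x hx => (hev x hx).self_of_nhds, fun x hx => ?_⟩
  · simp [productTest]
  · have hr : unreflect k (t - (1 + k * t)) = t + (1 + k * t) := by
      have : 1 - k ≠ 0 := by linarith
      unfold unreflect; field_simp; ring
    have h := reflPart_functional_equation (ξ := t - (1 + k * t)) hk0 hk1 hAB hN ht (by
      nlinarith [ht'.1])
    rw [reflSource, hr] at h
    simp only [productTest]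
    linarith
  · have : (fun s => productTest k A B N (x, s)) =ᶠ[𝓝 T] fun _ => 0 := hev x hx
    rw [this.deriv_eq, deriv_const]

/-- With `ξ = t - x` and `η = t + x` the d'Alembertian is `4 ∂_ξ ∂_η`, which annihilates every term
of one variable. -/
lemma box_productTest (hA : ContDiff ℝ 2 A) (hB : ContDiff ℝ 2 B) (N : ℕ) (x t : ℝ) :
    box (productTest k A B N) (x, t) = 4 * (deriv A (t - x) * deriv B (t + x)) := by
  have hH := contDiff_reflPart (k := k) hA hB N
  set H := reflPart k A B N with hHdef
  have hC : ContDiff ℝ 2 (fun y => A y * B y + H y) := by fun_prop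
  set C := fun y => A y * B y + H y with hCdef
  have d1 : ∀ {f : ℝ → ℝ}, ContDiff ℝ 2 f → ∀ y, HasDerivAt f (deriv f y) y := fun hf y =>
    (hf.differentiable (by norm_num) y).hasDerivAt
  have d2 : ∀ {f : ℝ → ℝ}, ContDiff ℝ 2 f → ∀ y, HasDerivAt (deriv f) (deriv (deriv f) y) y :=
    fun hf y => by
      have : ContDiff ℝ 1 (deriv _) := ((contDiff_succ_iff_deriv (n := 1)).1 hf).2.2
      exact (this.differentiable (by norm_num) y).hasDerivAt
  have sub_t : ∀ {f : ℝ → ℝ} {f'} {x s}, HasDerivAt f f' (s - x) →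
      HasDerivAt (fun s => f (s - x)) f' s := fun {f f' x s} h => h.comp_sub_const s x
  have add_t : ∀ {f : ℝ → ℝ} {f'} {x s}, HasDerivAt f f' (s + x) →
      HasDerivAt (fun s => f (s + x)) f' s := fun {f f' x s} h => h.comp_add_const s x
  have sub_x : ∀ {f : ℝ → ℝ} {f'} {t y}, HasDerivAt f f' (t - y) →
      HasDerivAt (fun y => f (t - y)) (-f') y := fun {f f' t y} h => h.comp_const_sub t y
  have add_x : ∀ {f : ℝ → ℝ} {f'} {t y}, HasDerivAt f f' (t + y) →
      HasDerivAt (fun y => f (t + y)) f' y := fun {f f' t y} h => h.comp_const_add t y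
  have ht1 : deriv (fun s => productTest k A B N (x, s)) = fun s =>
      deriv A (s - x) * B (s + x) + A (s - x) * deriv B (s + x) + deriv H (s - x) -
        deriv C (s + x) := by
    ext s
    exact ((((sub_t (d1 hA _)).mul (add_t (d1 hB _))).add (sub_t (d1 hH _))).sub
      (add_t (d1 hC _))).deriv
  have hx1 : deriv (fun y => productTest k A B N (y, t)) = fun y =>
      -deriv A (t - y) * B (t + y) + A (t - y) * deriv B (t + y) + -deriv H (t - y) -
        deriv C (t + y) := by
    ext s
    exact ((((sub_x (d1 hA _)).mul (add_x (d1 hB _))).add (sub_x (d1 hH _))).sub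
      (add_x (d1 hC _))).deriv
  simp only [box, iteratedDeriv_succ, iteratedDeriv_zero]
  have st {f : ℝ → ℝ} {f'} (h : HasDerivAt f f' (t - x)) := sub_t h
  have tt {f : ℝ → ℝ} {f'} (h : HasDerivAt f f' (t + x)) := add_t h
  have sx {f : ℝ → ℝ} {f'} (h : HasDerivAt f f' (t - x)) := sub_x h
  have tx {f : ℝ → ℝ} {f'} (h : HasDerivAt f f' (t + x)) := add_x h
  have ht2 := (((((st (d2 hA _)).mul (tt (d1 hB _))).add
    ((st (d1 hA _)).mul (tt (d2 hB _)))).add (st (d2 hH _))).sub (tt (d2 hC _))).deriv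
  have hx2 := (((((sx (d2 hA _)).neg.mul (tx (d1 hB _))).add
    ((sx (d1 hA _)).mul (tx (d2 hB _)))).add (sx (d2 hH _)).neg).sub (tx (d2 hC _))).deriv
  rw [ht1, hx1]
  refine (congrArg₂ (· - ·) ht2 hx2).trans ?_
  rw [Pi.neg_apply]
  ring

end ProductTest

/-- Integrating from the right end of the support makes the antiderivative vanish at later
characteristics, as the final conditions require. -/
lemma exists_antiderivative {a : ℝ → ℝ} (ha : ContDiff ℝ ∞ a) {ξ₁ : ℝ}
    (h : ∀ ξ, ξ₁ ≤ ξ → a ξ = 0) :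
    ∃ A : ℝ → ℝ, ContDiff ℝ 2 A ∧ deriv A = a ∧ ∀ ξ, ξ₁ ≤ ξ → A ξ = 0 := by
  have hd : ∀ ξ, HasDerivAt (fun ξ => ∫ y in ξ₁..ξ, a y) (a ξ) ξ := fun ξ =>
    intervalIntegral.integral_hasDerivAt_right (ha.continuous.intervalIntegrable _ _)
      ha.continuous.aestronglyMeasurable.stronglyMeasurableAtFilter ha.continuous.continuousAt
  have hd' : deriv (fun ξ => ∫ y in ξ₁..ξ, a y) = a := funext fun ξ => (hd ξ).deriv
  refine ⟨fun ξ => ∫ y in ξ₁..ξ, a y, ?_, hd', fun ξ hξ => ?_⟩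
  · rw [show (2 : WithTop ℕ∞) = 1 + 1 by norm_num, contDiff_succ_iff_deriv, hd']
    exact ⟨fun ξ => (hd ξ).differentiableAt, by simp, ha.of_le (by exact_mod_cast le_top)⟩
  · refine (intervalIntegral.integral_congr fun y hy => ?_).trans intervalIntegral.integral_zero
    rw [uIcc_of_le hξ] at hy
    exact h y hy.1

/-! ### Uniqueness of the solution by transposition -/

/-- Characteristic coordinates `(t - x, t + x)`. -/
def charEquiv : (ℝ × ℝ) ≃L[ℝ] (ℝ × ℝ) :=
  LinearEquiv.toContinuousLinearEquiv
    { toFun := fun p => (p.2 - p.1, p.2 + p.1)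
      invFun := fun q => ((q.2 - q.1) / 2, (q.2 + q.1) / 2)
      map_add' := fun p q => by ext <;> simp <;> ring
      map_smul' := fun c p => by ext <;> simp [mul_sub, mul_add]
      left_inv := fun p => by ext <;> simp
      right_inv := fun p => by ext <;> simp <;> ring }

@[simp] lemma charEquiv_apply (p : ℝ × ℝ) : charEquiv p = (p.2 - p.1, p.2 + p.1) := rfl

@[simp] lemma charEquiv_symm_apply (q : ℝ × ℝ) :
    charEquiv.symm q = ((q.2 - q.1) / 2, (q.2 + q.1) / 2) := rfl

/-- Only the vanishing of integrals and null sets are transported, so uniqueness of Haar measure is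
enough and the Jacobian need not be computed. -/
lemma exists_map_charEquiv : ∃ c : NNReal, c ≠ 0 ∧
    Measure.map charEquiv (volume : Measure (ℝ × ℝ)) = c • volume := by
  have : (Measure.map charEquiv (volume : Measure (ℝ × ℝ))).IsAddHaarMeasure :=
    ContinuousLinearEquiv.isAddHaarMeasure_map charEquiv volume
  exact ⟨_, (Measure.addHaarScalarFactor_pos_of_isAddHaarMeasure _ _).ne',
    Measure.isAddLeftInvariant_eq_smul _ _⟩

/-- The bound `p.2 + δ < T` keeps the latest time of the characteristic box below `T`, which leaves
room for the final conditions of the test functions built on it. -/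
lemma exists_char_box {k T : ℝ} {p : ℝ × ℝ} (hp : p ∈ Q k T) : ∃ δ > 0, p.2 + δ < T ∧
    charEquiv ⁻¹' (Ioo (p.2 - p.1 - δ) (p.2 - p.1 + δ) ×ˢ Ioo (p.2 + p.1 - δ) (p.2 + p.1 + δ)) ⊆
      Q k T := by
  have h1 : charEquiv.symm ⁻¹' Q k T ∈ 𝓝 (charEquiv p) :=
    charEquiv.symm.continuous.continuousAt.preimage_mem_nhds
      (by rw [ContinuousLinearEquiv.symm_apply_apply]; exact (isOpen_Q k T).mem_nhds hp)
  obtain ⟨ε, hε, hball⟩ := Metric.mem_nhds_iff.1 h1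
  have hT : p.2 < T := hp.1.2
  refine ⟨min ε ((T - p.2) / 2), lt_min hε (by linarith), ?_, ?_⟩
  · have := min_le_right ε ((T - p.2) / 2); linarith
  · rintro q ⟨⟨ha, hb⟩, hc, hd⟩
    have hm := min_le_left ε ((T - p.2) / 2)
    have : charEquiv q ∈ Metric.ball (charEquiv p) ε := by
      rw [Metric.mem_ball, Prod.dist_eq, max_lt_iff, Real.dist_eq, Real.dist_eq, abs_lt, abs_lt]
      simp only [charEquiv_apply] at *
      refine ⟨⟨?_, ?_⟩, ?_, ?_⟩ <;> linarith
    simpa using hball this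

/-- Being zero almost everywhere is a local matter. In a small characteristic box every product `a(t
- x) b(t + x)` of bump functions is, up to the factor 4, the d'Alembertian of a test function, and
such products are total. -/
theorem eq_zero_of_forall_isTest {k T : ℝ} (hk0 : 0 < k) (hk1 : k < 1) (U : L2 (Q k T))
    (h : ∀ θ, IsTest k T θ → ∫ p in Q k T, U p * box θ p = 0) : U = 0 := by
  have hfin : IsFiniteMeasure (volume.restrict (Q k T)) := ⟨by simpa using volume_Q_lt_top hk0⟩
  have hU : Integrable ((Q k T).indicator U) :=
    (integrable_indicator_iff (measurableSet_Q k T)).2 ((Lp.memLp U).integrable (by norm_num))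
  obtain ⟨c, hc, hmap⟩ := exists_map_charEquiv
  rw [Lp.eq_zero_iff_ae_eq_zero]
  change ∀ᵐ p ∂(volume.restrict (Q k T)), U p = 0
  rw [ae_restrict_iff' (measurableSet_Q k T), ae_iff]
  refine measure_null_of_locally_null _ fun p hp => ?_
  have hpQ : p ∈ Q k T := by
    by_contra hn
    exact hp fun h => absurd h hn
  obtain ⟨δ, hδ, hδT, hsub⟩ := exists_char_box hpQ
  set I := Ioo (p.2 - p.1 - δ) (p.2 - p.1 + δ) with hI
  set J := Ioo (p.2 + p.1 - δ) (p.2 + p.1 + δ) with hJ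
  have hIJ : MeasurableSet (I ×ˢ J) := measurableSet_Ioo.prod measurableSet_Ioo
  set W : ℝ × ℝ → ℝ := (I ×ˢ J).indicator fun q => (Q k T).indicator U (charEquiv.symm q) with hWdef
  have hemb : MeasurableEmbedding charEquiv := charEquiv.toHomeomorph.measurableEmbedding
  have hcomp : ∀ g : ℝ × ℝ → ℝ, c • ∫ q, g q = ∫ p, g (charEquiv p) := by
    intro g
    rw [← hemb.integral_map, hmap, integral_smul_nnreal_measure]
  have hWi : Integrable W := by
    have h1 : Integrable (W ∘ charEquiv) := by
      have : W ∘ charEquiv = (charEquiv ⁻¹' (I ×ˢ J)).indicator ((Q k T).indicator U) := by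
        ext q
        by_cases hq : charEquiv q ∈ I ×ˢ J
        · rw [indicator_of_mem (show q ∈ charEquiv ⁻¹' (I ×ˢ J) from hq), Function.comp, hWdef,
            indicator_of_mem hq, ContinuousLinearEquiv.symm_apply_apply]
        · rw [indicator_of_notMem (show q ∉ charEquiv ⁻¹' (I ×ˢ J) from hq), Function.comp, hWdef,
            indicator_of_notMem hq]
      rw [this]
      exact hU.indicator (charEquiv.continuous.measurable hIJ)
    rw [← hemb.integrable_map_iff, hmap] at h1
    exact (integrable_smul_measure (c := (c : ENNReal)) (by simpa using hc) (by simp)).1 h1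
  have hW0 : W =ᵐ[volume] 0 := by
    refine ae_eq_zero_of_forall_product_test isOpen_Ioo isOpen_Ioo hWi
      (fun q hq => indicator_of_notMem hq _) fun a b ha1 _ ha3 hb1 _ hb3 => ?_
    have ha0 : ∀ ξ, ξ ∉ I → a ξ = 0 := fun ξ hξ => image_eq_zero_of_notMem_tsupport fun h => hξ (ha3 h)
    have hb0 : ∀ ξ, ξ ∉ J → b ξ = 0 := fun ξ hξ => image_eq_zero_of_notMem_tsupport fun h => hξ (hb3 h)
    obtain ⟨A, hA, hdA, hA0⟩ := exists_antiderivative ha1 (ξ₁ := p.2 - p.1 + δ)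
      fun ξ hξ => ha0 ξ fun h => (not_lt.2 hξ) h.2
    obtain ⟨B, hB, hdB, hB0⟩ := exists_antiderivative hb1 (ξ₁ := p.2 + p.1 + δ)
      fun ξ hξ => hb0 ξ fun h => (not_lt.2 hξ) h.2
    -- If the half sum of `ξ` and `η` is at least `p.2 + δ`, one of the two lies beyond its
    -- interval, where its antiderivative vanishes.
    have hAB : ∀ ξ η, 2 * (p.2 + δ) ≤ ξ + η → A ξ * B η = 0 := by
      intro ξ η hs
      rcases le_or_gt (p.2 - p.1 + δ) ξ with h1 | h1
      · rw [hA0 ξ h1, zero_mul]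
      · rw [hB0 η (by linarith), mul_zero]
    obtain ⟨N, hN⟩ := exists_nat_ge (p.2 + δ)
    have htest := h _ (isTest_productTest hk0 hk1 hA hB hAB
      (by have : 0 < p.2 := hpQ.1.1
          linarith) hδT hN)
    have h0 : c • ∫ q, a q.1 * (b q.2 * W q) = 0 := by
      rw [hcomp, ← mul_zero (4⁻¹ : ℝ), ← htest, ← integral_indicator (measurableSet_Q k T),
        ← integral_const_mul]
      congr 1
      ext ⟨x, t⟩
      by_cases hq : (x, t) ∈ Q k T
      · simp only [indicator_of_mem hq, box_productTest hA hB, hdA, hdB, charEquiv_apply, hWdef]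
        by_cases hq2 : (t - x, t + x) ∈ I ×ˢ J
        · have e : charEquiv.symm (t - x, t + x) = (x, t) := charEquiv.symm_apply_apply (x, t)
          rw [indicator_of_mem hq2, e, indicator_of_mem hq]
          ring
        · rw [indicator_of_notMem hq2]
          rw [mem_prod, not_and_or] at hq2
          rcases hq2 with h2 | h2
          · simp [ha0 _ h2]
          · simp [hb0 _ h2]
      · have hq2 : (t - x, t + x) ∉ I ×ˢ J := fun h2 => hq (hsub h2)
        simp [hWdef, indicator_of_notMem hq, indicator_of_notMem hq2]
    exact (smul_eq_zero.1 h0).resolve_left hc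
  have hW1 : ∀ᵐ q, W (charEquiv q) = 0 := by
    have : ∀ᵐ q ∂(Measure.map charEquiv volume), W q = 0 := by
      rw [hmap]
      exact Measure.ae_smul_measure hW0 c
    exact ae_of_ae_map charEquiv.continuous.measurable.aemeasurable this
  refine ⟨{x | ¬(x ∈ Q k T → U x = 0)} ∩ charEquiv ⁻¹' (I ×ˢ J), ?_, ?_⟩
  · refine inter_mem self_mem_nhdsWithin (mem_nhdsWithin_of_mem_nhds ?_)
    refine ((isOpen_Ioo.prod isOpen_Ioo).preimage charEquiv.continuous).mem_nhds ?_
    simp only [mem_preimage, charEquiv_apply, mem_prod, mem_Ioo]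
    refine ⟨⟨?_, ?_⟩, ?_, ?_⟩ <;> linarith
  · refine measure_mono_null ?_ (ae_iff.1 hW1)
    rintro q ⟨hq1, hq2⟩
    simp only [mem_ofPred_eq, Classical.not_imp] at hq1 ⊢
    have e : W (charEquiv q) = U q := by
      rw [hWdef, indicator_of_mem (show charEquiv q ∈ I ×ˢ J from hq2),
        ContinuousLinearEquiv.symm_apply_apply,
        indicator_of_mem hq1.1]
    rw [e]
    exact hq1.2

/-! ### Curves in `L²` -/

lemma norm_sq_eq_integral {α : Type} [MeasureSpace α] {s : Set α} (f : L2 s) :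
    ‖f‖ ^ 2 = ∫ x in s, (f x) ^ 2 := by
  rw [← real_inner_self_eq_norm_sq, L2.inner_def]
  congr 1; ext x; simp [sq]

lemma exists_continuous_translate {F : ℝ → ℝ} (hF : MemLp F 2) (s : Set ℝ) :
    ∃ g : ℝ → L2 s, Continuous g ∧ ∀ t, g t =ᵐ[volume.restrict s] fun x => F (t + x) := by
  refine ⟨fun t => LpToLpRestrictCLM ℝ ℝ ℝ volume 2 s (DomAddAct.mk t +ᵥ hF.toLp F), ?_,
    fun t => ?_⟩
  · have : Fact ((2 : ENNReal) ≠ ⊤) := ⟨by norm_num⟩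
    have h : Continuous fun t : ℝ => DomAddAct.mk t +ᵥ hF.toLp F :=
      DomAddAct.continuous_mk.vadd continuous_const
    exact (LpToLpRestrictCLM ℝ ℝ ℝ volume 2 s).continuous.comp h
  · refine (LpToLpRestrictCLM_coeFn ℝ s _).trans (ae_restrict_of_ae ?_)
    refine (DomAddAct.vadd_Lp_ae_eq _ _).trans ?_
    exact (measurePreserving_add_left volume t).quasiMeasurePreserving.ae_eq hF.coeFn_toLp

lemma exists_continuous_reflect_translate {F : ℝ → ℝ} (hF : MemLp F 2) (s : Set ℝ) :
    ∃ g : ℝ → L2 s, Continuous g ∧ ∀ t, g t =ᵐ[volume.restrict s] fun x => F (t - x) := by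
  have hF' : MemLp (fun x => F (-x)) 2 :=
    hF.comp_measurePreserving (Measure.measurePreserving_neg volume)
  obtain ⟨g, hg, hg'⟩ := exists_continuous_translate hF' s
  refine ⟨fun t => g (-t), hg.comp continuous_neg, fun t => (hg' (-t)).trans (.of_forall fun x => ?_)⟩
  simp only []
  congr 1; ring

/-- Truncation of a function to the half line left of `c`. -/
def cut {s : Set ℝ} (c : ℝ) (f : L2 s) : L2 s :=
  ((Lp.memLp f).indicator (measurableSet_Iio (a := c))).toLp _

lemma cut_coeFn {s : Set ℝ} (c : ℝ) (f : L2 s) :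
    cut c f =ᵐ[volume.restrict s] (Iio c).indicator f :=
  MemLp.coeFn_toLp _

lemma norm_cut_sub_le {s : Set ℝ} (c : ℝ) (f g : L2 s) : ‖cut c f - cut c g‖ ≤ ‖f - g‖ := by
  refine Lp.norm_le_norm_of_ae_le ?_
  filter_upwards [cut_coeFn c f, cut_coeFn c g, Lp.coeFn_sub (cut c f) (cut c g),
    Lp.coeFn_sub f g] with x h1 h2 h3 h4
  rw [h3, h4, Pi.sub_apply, Pi.sub_apply, h1, h2]
  by_cases h : x ∈ Iio c
  · rw [indicator_of_mem h, indicator_of_mem h]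
  · rw [indicator_of_notMem h, indicator_of_notMem h, sub_zero, norm_zero]
    exact norm_nonneg _

/-- Dominated convergence: the indicators converge at every `x ≠ c₀`. -/
lemma tendsto_cut {s : Set ℝ} (f : L2 s) (c₀ : ℝ) :
    Tendsto (fun c => ‖cut c f - cut c₀ f‖) (𝓝 c₀) (𝓝 0) := by
  have h1 : Tendsto (fun c => ∫ x in s, ((Iio c).indicator f x - (Iio c₀).indicator f x) ^ 2)
      (𝓝 c₀) (𝓝 (∫ _ in s, (0 : ℝ))) := by
    refine tendsto_integral_filter_of_dominated_convergence (fun x => (f x) ^ 2)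
      (.of_forall fun c => ?_) (.of_forall fun c => .of_forall fun x => ?_)
      (Lp.memLp f).integrable_sq ?_
    · exact (((Lp.aestronglyMeasurable f).indicator measurableSet_Iio).sub
        ((Lp.aestronglyMeasurable f).indicator measurableSet_Iio)).pow 2
    · by_cases ha : x ∈ Iio c <;> by_cases hb : x ∈ Iio c₀ <;> simp [ha, hb] <;> positivity
    · have : ∀ᵐ x ∂(volume.restrict s), x ≠ c₀ := ae_restrict_of_ae (Measure.ae_ne volume c₀)
      filter_upwards [this] with x hx
      refine tendsto_const_nhds.congr' ?_
      rcases lt_or_gt_of_ne hx with h | h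
      · filter_upwards [lt_mem_nhds h] with c hc
        simp [h, hc]
      · filter_upwards [gt_mem_nhds h] with c hc
        simp [h.le, hc.le]
  have h2 : ∀ c, ∫ x in s, ((Iio c).indicator f x - (Iio c₀).indicator f x) ^ 2 =
      ‖cut c f - cut c₀ f‖ ^ 2 := by
    intro c
    rw [norm_sq_eq_integral]
    refine integral_congr_ae ?_
    filter_upwards [cut_coeFn c f, cut_coeFn c₀ f, Lp.coeFn_sub (cut c f) (cut c₀ f)]
      with x h1 h2 h3
    rw [h3, Pi.sub_apply, h1, h2]
  simp only [h2, integral_zero] at h1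
  have h3 := h1.sqrt
  simpa [Real.sqrt_sq (norm_nonneg _)] using h3

lemma continuous_cut {s : Set ℝ} {f : ℝ → L2 s} (hf : Continuous f) {c : ℝ → ℝ}
    (hc : Continuous c) : Continuous fun t => cut (c t) (f t) := by
  refine continuous_iff_continuousAt.2 fun t₀ => ?_
  rw [ContinuousAt, tendsto_iff_norm_sub_tendsto_zero]
  have h1 := tendsto_iff_norm_sub_tendsto_zero.1 (hf.tendsto t₀)
  have h2 := (tendsto_cut (f t₀) (c t₀)).comp (hc.tendsto t₀)
  refine squeeze_zero (fun _ => norm_nonneg _) (fun t => ?_) (by simpa using h1.add h2)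
  calc ‖cut (c t) (f t) - cut (c t₀) (f t₀)‖
      = ‖(cut (c t) (f t) - cut (c t) (f t₀)) + (cut (c t) (f t₀) - cut (c t₀) (f t₀))‖ := by
        congr 1; abel
    _ ≤ _ := (norm_add_le _ _).trans (add_le_add_left (norm_cut_sub_le _ _ _) _)

/-! ### Existence of the state -/

lemma Om_subset {k t T : ℝ} (hk : 0 < k) (h : t ≤ T) : Om k t ⊆ Om k T :=
  Ioo_subset_Ioo_right (by nlinarith)

lemma isState_of_profile {k T : ℝ} (hk0 : 0 < k) (hk1 : k < 1) (hT : 0 < T) {F : ℝ → ℝ}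
    (hF : MemLp F 2) (hF0 : ∀ t ≤ 0, F t = 0) {w : Control T}
    (hw : ∀ᵐ t ∂(volume.restrict (Ioo 0 T)), w t = F t - F (reflect k t))
    {f g : ℝ → L2 (Om k T)} (hf : Continuous f) (hg : Continuous g)
    (hfF : ∀ t, f t =ᵐ[volume.restrict (Om k T)] fun x => F (t - x))
    (hgF : ∀ t, g t =ᵐ[volume.restrict (Om k T)] fun x => F (reflect k (t + x))) :
    ∃ U : L2 (Q k T), IsState k T w U fun t => cut (1 + k * t) (f t - g t) := by
  have hU := (memLp_left_Q (k := k) (T := T) hF).sub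
    (memLp_right_Q (k := k) (T := T) (memLp_comp_reflect hk0 hk1 hF))
  set V : L2 (Q k T) := hU.toLp _ with hV
  have hUe : V =ᵐ[volume.restrict (Q k T)]
      fun p => F (p.2 - p.1) - F (reflect k (p.2 + p.1)) := hU.coeFn_toLp
  refine ⟨V, ⟨?_, fun t ht => ?_, ?_, fun θ hθ => ?_⟩⟩
  · exact (continuous_cut (hf.sub hg) (by fun_prop)).continuousOn
  · filter_upwards [cut_coeFn (1 + k * t) (f t - g t), ae_restrict_mem measurableSet_Ioo]
      with x hx hxm hxt
    rw [hx, indicator_of_notMem]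
    exact fun h => hxt ⟨hxm.1, h⟩
  · rw [Filter.EventuallyEq, ae_restrict_iff' (measurableSet_Q k T)] at hUe
    -- Fubini fixes the first coordinate, whereas slices at fixed time are wanted; hence the swap.
    have h1 : ∀ᵐ q : ℝ × ℝ, q.swap ∈ Q k T → V q.swap =
        F (q.1 - q.2) - F (reflect k (q.1 + q.2)) :=
      (Measure.measurePreserving_swap (μ := (volume : Measure ℝ))
        (ν := (volume : Measure ℝ))).quasiMeasurePreserving.ae hUe
    have h2 : ∀ᵐ t : ℝ, ∀ᵐ x : ℝ, (x, t) ∈ Q k T → V (x, t) =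
        F (t - x) - F (reflect k (t + x)) := Measure.ae_ae_of_ae_prod h1
    filter_upwards [ae_restrict_of_ae h2, ae_restrict_mem measurableSet_Ioo] with t ht htm
    have hm := Measure.restrict_mono (μ := volume) (Om_subset hk0 htm.2.le) le_rfl
    have h3 := ae_mono hm (cut_coeFn (1 + k * t) (f t - g t))
    filter_upwards [h3, ae_mono hm (Lp.coeFn_sub (f t) (g t)), ae_mono hm (hfF t),
      ae_mono hm (hgF t), ae_restrict_of_ae ht, ae_restrict_mem measurableSet_Ioo]
      with x a1 a2 a3 a4 a5 a6
    rw [a5 ⟨htm, a6⟩, a1, indicator_of_mem (show x ∈ Iio (1 + k * t) from a6.2), a2,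
      Pi.sub_apply, a3, a4]
  · have h1 : ∫ p in Q k T, V p * box θ p =
        ∫ p in Q k T, (F (p.2 - p.1) - F (reflect k (p.2 + p.1))) * box θ p := by
      refine integral_congr_ae ?_
      filter_upwards [hUe] with p hp
      rw [hp]
    rw [h1, transposition_identity hk0 hk1 hT hθ hF hF0]
    refine integral_congr_ae ?_
    filter_upwards [hw] with t ht
    rw [ht]

/-! ### Uniqueness and linearity -/

lemma integral_mul_eq_inner {α : Type} [MeasureSpace α] {s : Set α} (f : L2 s) {g : α → ℝ}
    (hg : MemLp g 2 (volume.restrict s)) : ∫ x in s, f x * g x = inner ℝ (hg.toLp g) f := by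
  rw [L2.inner_def]
  refine integral_congr_ae ?_
  filter_upwards [hg.coeFn_toLp] with x hx
  simp [hx]

/-- The transposition identity against all test functions. -/
def IsTransposition (k T : ℝ) (w : Control T) (U : L2 (Q k T)) : Prop :=
  ∀ θ : ℝ × ℝ → ℝ, IsTest k T θ →
    (∫ p in Q k T, U p * box θ p) = ∫ t in Ioo 0 T, w t * deriv (fun x => θ (x, t)) 0

lemma isTransposition_iff {k T : ℝ} (hk : 0 < k) {w : Control T} {U : L2 (Q k T)} :
    IsTransposition k T w U ↔ ∀ θ (hθ : IsTest k T θ),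
      inner ℝ ((memLp_continuous_Q hk (continuous_box hθ.smooth)).toLp _) U =
        inner ℝ ((memLp_flux (T := T) hθ.smooth).toLp _) w := by
  refine forall_congr' fun θ => forall_congr' fun hθ => ?_
  rw [integral_mul_eq_inner U (memLp_continuous_Q hk (continuous_box hθ.smooth)),
    integral_mul_eq_inner w (memLp_flux hθ.smooth)]

lemma IsTransposition.add {k T : ℝ} (hk : 0 < k) {w w' : Control T} {U U' : L2 (Q k T)}
    (h : IsTransposition k T w U) (h' : IsTransposition k T w' U') :
    IsTransposition k T (w + w') (U + U') := by
  rw [isTransposition_iff hk] at *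
  intro θ hθ
  rw [inner_add_right, inner_add_right, h θ hθ, h' θ hθ]

lemma IsTransposition.smul {k T : ℝ} (hk : 0 < k) {w : Control T} {U : L2 (Q k T)}
    (h : IsTransposition k T w U) (c : ℝ) : IsTransposition k T (c • w) (c • U) := by
  rw [isTransposition_iff hk] at *
  intro θ hθ
  rw [inner_smul_right, inner_smul_right, h θ hθ]

lemma IsTransposition.unique {k T : ℝ} (hk0 : 0 < k) (hk1 : k < 1) {w : Control T}
    {U U' : L2 (Q k T)} (h : IsTransposition k T w U) (h' : IsTransposition k T w U') :
    U = U' := by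
  rw [← sub_eq_zero]
  refine eq_zero_of_forall_isTest hk0 hk1 _ fun θ hθ => ?_
  rw [integral_mul_eq_inner _ (memLp_continuous_Q hk0 (continuous_box hθ.smooth)),
    inner_sub_right, (isTransposition_iff hk0).1 h θ hθ, (isTransposition_iff hk0).1 h' θ hθ,
    sub_self]

lemma isClosed_isTransposition {k T : ℝ} (hk : 0 < k) :
    IsClosed {p : Control T × L2 (Q k T) | IsTransposition k T p.1 p.2} := by
  simp only [isTransposition_iff hk, ofPred_forall]
  refine isClosed_iInter fun θ => isClosed_iInter fun hθ => ?_
  exact isClosed_eq (continuous_const.inner continuous_snd) (continuous_const.inner continuous_fst)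

lemma IsState.isTransposition {k T : ℝ} {w : Control T} {U : L2 (Q k T)} {u : ℝ → L2 (Om k T)}
    (h : IsState k T w U u) : IsTransposition k T w U := h.transposition

lemma IsState.curve_unique {k T : ℝ} (hT : 0 < T) {w w' : Control T}
    {U : L2 (Q k T)} {u u' : ℝ → L2 (Om k T)} (h : IsState k T w U u)
    (h' : IsState k T w' U u') : EqOn u u' (Icc 0 T) := by
  refine Measure.eqOn_Icc_of_ae_eq volume hT.ne ?_ h.continuousOn h'.continuousOn
  rw [← restrict_Ioo_eq_restrict_Icc]
  filter_upwards [h.slice, h'.slice, ae_restrict_mem measurableSet_Ioo] with t h1 h2 ht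
  have ht' := Ioo_subset_Icc_self ht
  refine Lp.ext ?_
  rw [ae_restrict_iff' (show MeasurableSet (Om k t) from measurableSet_Ioo)] at h1 h2
  filter_upwards [ae_restrict_of_ae h1, ae_restrict_of_ae h2, h.support t ht', h'.support t ht']
    with x a1 a2 a3 a4
  by_cases hx : x ∈ Om k t
  · rw [← a1 hx, a2 hx]
  · rw [a3 hx, a4 hx]

/-! ### Estimates in `H¹₀` -/

lemma sq_setIntegral_le {s A : Set ℝ} (f : L2 s) (hA : MeasurableSet A)
    (hA' : volume.restrict s A ≠ ⊤) :
    (∫ x in A, f x ∂(volume.restrict s)) ^ 2 ≤ (volume.restrict s).real A * ‖f‖ ^ 2 := by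
  set e : L2 s := indicatorConstLp 2 hA hA' 1 with he
  have h1 : ∀ g : L2 s, inner ℝ e g = ∫ x in A, g x ∂(volume.restrict s) := fun g =>
    L2.inner_indicatorConstLp_one hA hA' g
  have h2 : ‖e‖ ^ 2 = (volume.restrict s).real A := by
    rw [← real_inner_self_eq_norm_sq, h1]
    have : ∫ x in A, e x ∂(volume.restrict s) = ∫ x in A, (1 : ℝ) ∂(volume.restrict s) := by
      refine integral_congr_ae ?_
      filter_upwards [ae_restrict_of_ae (indicatorConstLp_coeFn (hs := hA) (hμs := hA') (c := (1:ℝ))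
        (p := 2)), ae_restrict_mem hA] with x hx hxA
      rw [he, hx, indicator_of_mem hxA]
    rw [this]; simp
  rw [← h1, ← h2, ← mul_pow, ← sq_abs]
  exact pow_le_pow_left₀ (abs_nonneg _) (abs_real_inner_le_norm e f) 2

/-- Cauchy–Schwarz for `φ x = -∫ φ'` over `(x, b)`, using `φ b = 0`. -/
lemma sq_le_of_mem_testGraph {b : ℝ} {p : WithLp 2 (L2 (Ioo 0 b) × L2 (Ioo 0 b))} {φ : ℝ → ℝ}
    (h1 : ContDiff ℝ ∞ φ) (h3 : tsupport φ ⊆ Ioo 0 b)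
    (h5 : p.snd =ᵐ[volume.restrict (Ioo 0 b)] deriv φ) {x : ℝ} (hx : x ∈ Ioo 0 b) :
    φ x ^ 2 ≤ (b - x) * ‖p.snd‖ ^ 2 := by
  have hb : φ b = 0 := image_eq_zero_of_notMem_tsupport fun h => lt_irrefl _ (h3 h).2
  have hsub : Ioo x b ⊆ Ioo 0 b := Ioo_subset_Ioo_left hx.1.le
  have hr : (volume.restrict (Ioo 0 b)).restrict (Ioo x b) = volume.restrict (Ioo x b) :=
    Measure.restrict_restrict_of_subset hsub
  have h6 : ∫ y in Ioo x b, p.snd y ∂(volume.restrict (Ioo 0 b)) = - φ x := by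
    rw [hr]
    have : ∫ y in Ioo x b, p.snd y = ∫ y in Ioo x b, deriv φ y :=
      integral_congr_ae (ae_mono (Measure.restrict_mono hsub le_rfl) h5)
    rw [this, ← integral_Ioc_eq_integral_Ioo, ← intervalIntegral.integral_of_le hx.2.le,
      intervalIntegral.integral_deriv_eq_sub (fun y _ => h1.differentiable (by simp) y)
        ((h1.continuous_deriv (by simp)).intervalIntegrable _ _), hb, zero_sub]
  have hv : volume.restrict (Ioo 0 b) (Ioo x b) = ENNReal.ofReal (b - x) := by
    rw [Measure.restrict_apply measurableSet_Ioo, inter_eq_left.2 hsub, Real.volume_Ioo]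
  have h7 := sq_setIntegral_le p.snd (A := Ioo x b) measurableSet_Ioo (by rw [hv]; simp)
  rw [h6, measureReal_def, hv, ENNReal.toReal_ofReal (by linarith [hx.2]), neg_sq] at h7
  exact h7

lemma H10_induction {I : Set ℝ} {C : Set (WithLp 2 (L2 I × L2 I))} (hC : IsClosed C)
    (h : ∀ p ∈ testGraph I, p ∈ C) (p : H10 I) : (p : WithLp 2 (L2 I × L2 I)) ∈ C :=
  closure_minimal (s := (testGraph I : Set (WithLp 2 (L2 I × L2 I)))) h hC p.2

lemma continuous_cut_right {s : Set ℝ} (c : ℝ) : Continuous (cut c : L2 s → L2 s) := by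
  refine LipschitzWith.continuous (K := 1) (LipschitzWith.of_dist_le_mul fun f g => ?_)
  rw [dist_eq_norm, dist_eq_norm, NNReal.coe_one, one_mul]
  exact norm_cut_sub_le c f g

/-- On `[c, b)` the pointwise bound gives `φ² ≤ (b - c) ‖φ'‖²`, and integration over this strip
supplies the second factor `b - c`. Gaining a full power of the width is what makes the moving
truncation harmless in `H⁻¹`; with `c = 0` this is Poincaré's inequality. -/
lemma norm_fst_sub_cut_le {b c : ℝ} (hcb : c ≤ b) (p : H10 (Ioo 0 b)) :
    ‖p.1.fst - cut c p.1.fst‖ ≤ (b - c) * ‖p.1.snd‖ := by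
  refine H10_induction (C := {p | ‖p.fst - cut c p.fst‖ ≤ (b - c) * ‖p.snd‖}) ?_ ?_ p
  · have h1 : Continuous fun p : WithLp 2 (L2 (Ioo 0 b) × L2 (Ioo 0 b)) => p.fst :=
      WithLp.continuous_fst _ _ _
    have h2 : Continuous fun p : WithLp 2 (L2 (Ioo 0 b) × L2 (Ioo 0 b)) => p.snd :=
      WithLp.continuous_snd _ _ _
    exact isClosed_le (h1.sub ((continuous_cut_right c).comp h1)).norm
      (continuous_const.mul h2.norm)
  · rintro p ⟨φ, h1, h2, h3, h4, h5⟩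
    refine abs_le_of_sq_le_sq' ?_ (mul_nonneg (by linarith) (norm_nonneg _)) |>.2
    rw [norm_sq_eq_integral]
    have e1 : ∫ x in Ioo 0 b, ((p.fst - cut c p.fst : L2 (Ioo 0 b)) x) ^ 2 ≤
        ∫ x in Ioo 0 b, (Ico c b).indicator (fun _ => (b - c) * ‖p.snd‖ ^ 2) x := by
      refine integral_mono_ae (Lp.memLp _).integrable_sq
        ((integrable_const _).indicator measurableSet_Ico) ?_
      filter_upwards [Lp.coeFn_sub p.fst (cut c p.fst), cut_coeFn c p.fst, h4,
        ae_restrict_mem measurableSet_Ioo] with x a1 a2 a3 a4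
      rw [a1, Pi.sub_apply, a2]
      rcases lt_or_ge x c with hx | hx
      · rw [indicator_of_mem (show x ∈ Iio c from hx),
          indicator_of_notMem (fun h => (not_le.2 hx) h.1)]
        simp
      · rw [indicator_of_notMem (show x ∉ Iio c from not_lt.2 hx),
          indicator_of_mem (show x ∈ Ico c b from ⟨hx, a4.2⟩), sub_zero, a3]
        refine (sq_le_of_mem_testGraph h1 h3 h5 a4).trans ?_
        exact mul_le_mul_of_nonneg_right (by linarith) (sq_nonneg _)
    refine e1.trans ?_
    rw [integral_indicator measurableSet_Ico, integral_const, smul_eq_mul]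
    have e2 : ((volume.restrict (Ioo 0 b)).restrict (Ico c b)).real univ ≤ b - c := by
      rw [measureReal_def, Measure.restrict_apply_univ]
      refine ENNReal.toReal_le_of_le_ofReal (by linarith) ?_
      exact (Measure.restrict_apply_le _ _).trans (by rw [Real.volume_Ico])
    calc _ ≤ (b - c) * ((b - c) * ‖p.snd‖ ^ 2) :=
          mul_le_mul_of_nonneg_right e2 (mul_nonneg (by linarith) (sq_nonneg _))
      _ = _ := by ring

lemma norm_fst_le {b : ℝ} (hb : 0 ≤ b) (p : H10 (Ioo 0 b)) : ‖p.1.fst‖ ≤ b * ‖p.1.snd‖ := by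
  have h := norm_fst_sub_cut_le hb p
  have h0 : cut 0 p.1.fst = 0 := by
    rw [Lp.eq_zero_iff_ae_eq_zero]
    filter_upwards [cut_coeFn 0 p.1.fst, ae_restrict_mem measurableSet_Ioo] with x h1 h2
    rw [h1, indicator_of_notMem (show x ∉ Iio 0 from not_lt.2 h2.1.le)]; rfl
  rwa [h0, sub_zero, sub_zero] at h

/-! ### Elements of `H⁻¹` as derivatives -/

/-- The functional `φ ↦ ∫ v φ'`, that is, `-v'`. -/
def gradPairing {I : Set ℝ} (v : L2 I) : Hm1 I :=
  (innerSL ℝ (WithLp.toLp 2 ((0 : L2 I), v))).comp (H10 I).subtypeL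

lemma gradPairing_apply {I : Set ℝ} (v : L2 I) (p : H10 I) :
    gradPairing v p = inner ℝ v p.1.snd := by
  change inner ℝ (WithLp.toLp 2 ((0 : L2 I), v)) p.1 = _
  rw [WithLp.prod_inner_apply]
  simp

lemma toHm1_apply {I : Set ℝ} (y : L2 I) (p : H10 I) : toHm1 y p = inner ℝ y p.1.fst := by
  change inner ℝ (WithLp.toLp 2 (y, (0 : L2 I))) p.1 = _
  rw [WithLp.prod_inner_apply]
  simp

/-- The inner product as a continuous bilinear map. -/
def innerBilin (E : Type*) [NormedAddCommGroup E] [InnerProductSpace ℝ E] : E →L[ℝ] E →L[ℝ] ℝ :=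
  (isBoundedBilinearMap_inner (𝕜 := ℝ) (E := E)).toContinuousLinearMap

/-- By Poincaré's inequality `∫ q' p'` is coercive on `H¹₀`. Lax–Milgram yields `q` with `∫ q' p' =
L p`, and `v = q'` represents `L`. -/
theorem gradPairing_surjective {b : ℝ} (hb : 0 ≤ b) :
    Function.Surjective (gradPairing : L2 (Ioo 0 b) → Hm1 (Ioo 0 b)) := by
  intro L
  set D : H10 (Ioo 0 b) →L[ℝ] L2 (Ioo 0 b) :=
    (WithLp.sndL 2 ℝ (L2 (Ioo 0 b)) (L2 (Ioo 0 b))).comp (H10 (Ioo 0 b)).subtypeL with hD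
  have hDp : ∀ p, D p = p.1.snd := fun p => rfl
  set B := (innerBilin (L2 (Ioo 0 b))).bilinearComp D D with hB
  have hco : IsCoercive B := by
    refine ⟨(b ^ 2 + 1)⁻¹, by positivity, fun p => ?_⟩
    have h1 : B p p = ‖p.1.snd‖ ^ 2 := by
      rw [← real_inner_self_eq_norm_sq]; rfl
    have h2 : ‖p‖ ^ 2 = ‖p.1.fst‖ ^ 2 + ‖p.1.snd‖ ^ 2 := WithLp.prod_norm_sq_eq_of_L2 p.1
    have h3 : ‖p.1.fst‖ ^ 2 ≤ (b * ‖p.1.snd‖) ^ 2 :=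
      pow_le_pow_left₀ (norm_nonneg _) (norm_fst_le hb p) 2
    rw [h1, mul_assoc, ← sq, h2, inv_mul_le_iff₀ (by positivity)]
    nlinarith
  set l := (InnerProductSpace.toDual ℝ (H10 (Ioo 0 b))).symm L with hl
  set q := hco.continuousLinearEquivOfBilin.symm l with hq
  refine ⟨D q, ?_⟩
  ext p
  have h1 : inner ℝ l p = L p := InnerProductSpace.toDual_symm_apply
  have h2 := hco.continuousLinearEquivOfBilin_apply q p
  rw [hq, ContinuousLinearEquiv.apply_symm_apply, h1] at h2
  rw [gradPairing_apply, h2]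
  rfl

/-! ### The velocity of the state in `H⁻¹` -/

lemma hasDerivAt_integral_sub {F φ : ℝ → ℝ} (hF : LocallyIntegrable F) (h1 : ContDiff ℝ 1 φ)
    (h2 : HasCompactSupport φ) (s : ℝ) :
    HasDerivAt (fun s => ∫ x, φ x * F (s - x)) (∫ x, deriv φ x * F (s - x)) s :=
  h2.hasDerivAt_convolution_left (ContinuousLinearMap.mul ℝ ℝ) h1 hF s

lemma hasDerivAt_integral_add {G φ : ℝ → ℝ} (hG : LocallyIntegrable G) (h1 : ContDiff ℝ 1 φ)
    (h2 : HasCompactSupport φ) (s : ℝ) :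
    HasDerivAt (fun s => ∫ x, φ x * G (s + x)) (-∫ x, deriv φ x * G (s + x)) s := by
  have h := hasDerivAt_integral_sub hG (h1.comp contDiff_neg)
    (h2.comp_homeomorph (Homeomorph.neg ℝ)) s
  have e1 : ∀ s, ∫ x, (φ ∘ Neg.neg) x * G (s - x) = ∫ x, φ x * G (s + x) := fun s => by
    rw [← integral_neg_eq_self]
    simp
  have e2 : ∫ x, deriv (φ ∘ Neg.neg) x * G (s - x) = -∫ x, deriv φ x * G (s + x) := by
    rw [← integral_neg_eq_self, ← integral_neg]
    congr 1; ext x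
    have : deriv (φ ∘ Neg.neg) (-x) = -deriv φ x := by
      change deriv (fun y => φ (-y)) (-x) = _
      rw [deriv_comp_neg, neg_neg]
    rw [this]; simp
  rw [e2] at h
  refine h.congr_of_eventuallyEq (.of_forall fun s => ?_)
  exact (e1 s).symm

lemma inner_eq_integral_of_tsupport {I : Set ℝ} {y z : L2 I} {H ψ : ℝ → ℝ}
    (hy : y =ᵐ[volume.restrict I] H) (hz : z =ᵐ[volume.restrict I] ψ) (h : tsupport ψ ⊆ I) :
    inner ℝ y z = ∫ x, ψ x * H x := by
  rw [L2.inner_def]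
  have e1 : ∫ x in I, inner ℝ (y x) (z x) = ∫ x in I, ψ x * H x := by
    refine integral_congr_ae ?_
    filter_upwards [hy, hz] with x h1 h2
    rw [h1, h2]; simp
  rw [e1, setIntegral_eq_integral_of_forall_compl_eq_zero]
  intro x hx
  rw [image_eq_zero_of_notMem_tsupport fun h' => hx (h h'), zero_mul]

section Velocity

variable {I : Set ℝ} {F G : ℝ → ℝ} {f g : ℝ → L2 I}

/-- Against a test function, `F (t - x) - G (t + x)` has time derivative `∫ (F (t - x) + G (t + x))
φ'`. The remainder is bounded by `‖φ'‖` alone, so the estimate passes to the closure `H¹₀`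
uniformly, as an operator norm bound requires. -/
lemma abs_inner_sub_le_of_profile (hF : MemLp F 2) (hG : MemLp G 2)
    (hfF : ∀ t, f t =ᵐ[volume.restrict I] fun x => F (t - x))
    (hgG : ∀ t, g t =ᵐ[volume.restrict I] fun x => G (t + x)) {t T ε : ℝ}
    (htT : t ≤ T) (hε : ∀ s ∈ Icc t T, ‖(f s + g s) - (f T + g T)‖ ≤ ε) (p : H10 I) :
    |inner ℝ (f t - g t) p.1.fst - inner ℝ (f T - g T) p.1.fst -
      (t - T) * inner ℝ (f T + g T) p.1.snd| ≤ ε * (T - t) * ‖p.1.snd‖ := by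
  refine H10_induction (C := {p | |inner ℝ (f t - g t) p.fst - inner ℝ (f T - g T) p.fst -
      (t - T) * inner ℝ (f T + g T) p.snd| ≤ ε * (T - t) * ‖p.snd‖}) ?_ ?_ p
  · have h1 : Continuous fun p : WithLp 2 (L2 I × L2 I) => p.fst :=
      WithLp.continuous_fst _ _ _
    have h2 : Continuous fun p : WithLp 2 (L2 I × L2 I) => p.snd :=
      WithLp.continuous_snd _ _ _
    exact isClosed_le (((continuous_const.inner h1).sub (continuous_const.inner h1)).sub
      (continuous_const.mul (continuous_const.inner h2))).abs (continuous_const.mul h2.norm)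
  · rintro p ⟨φ, h1, h2, h3, h4, h5⟩
    have h1' : ContDiff ℝ 1 φ := h1.of_le (by exact_mod_cast le_top)
    have h3' : tsupport (deriv φ) ⊆ I := (tsupport_deriv_subset).trans h3
    have lF : LocallyIntegrable F := hF.locallyIntegrable (by norm_num)
    have lG : LocallyIntegrable G := hG.locallyIntegrable (by norm_num)
    have hd : ∀ s, HasDerivAt (fun s => inner ℝ (f s - g s) p.fst) (inner ℝ (f s + g s) p.snd) s := by
      intro s
      have e := (hasDerivAt_integral_sub lF h1' h2 s).sub (hasDerivAt_integral_add lG h1' h2 s)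
      rw [← inner_eq_integral_of_tsupport (hfF s) h5 h3',
        ← inner_eq_integral_of_tsupport (hgG s) h5 h3', sub_neg_eq_add, ← inner_add_left] at e
      refine e.congr_of_eventuallyEq (.of_forall fun s => ?_)
      simp only [Pi.sub_apply]
      rw [inner_sub_left, inner_eq_integral_of_tsupport (hfF s) h4 h3,
        inner_eq_integral_of_tsupport (hgG s) h4 h3]
    -- Removing the tangent makes the derivative small on `[t, T]`, so the mean value inequality
    -- bounds the remainder.
    have hN : ∀ s, HasDerivAt
        (fun s => inner ℝ (f s - g s) p.fst - s * inner ℝ (f T + g T) p.snd)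
        (inner ℝ ((f s + g s) - (f T + g T)) p.snd) s := by
      intro s
      rw [inner_sub_left]
      have h := (hd s).sub ((hasDerivAt_id' s).mul_const (inner ℝ (f T + g T) p.snd))
      rw [one_mul] at h
      exact h
    have hmv := (convex_Icc t T).norm_image_sub_le_of_norm_hasDerivWithin_le
      (C := ε * ‖p.snd‖) (fun s _ => (hN s).hasDerivWithinAt) (fun s hs => ?_)
      (right_mem_Icc.2 htT) (left_mem_Icc.2 htT)
    · rw [Real.norm_eq_abs, Real.norm_eq_abs, abs_sub_comm t T, abs_of_nonneg (sub_nonneg.2 htT)]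
        at hmv
      refine (le_of_eq ?_).trans (hmv.trans (le_of_eq (by ring)))
      congr 1; ring
    · refine (norm_inner_le_norm _ _).trans ?_
      exact mul_le_mul_of_nonneg_right (hε s hs) (norm_nonneg _)

end Velocity

/-- Only the strip `[c, b)` contributes, and there elements of `H¹₀` are small. -/
lemma abs_inner_sub_cut_le {b c : ℝ} (hcb : c ≤ b) (h : L2 (Ioo 0 b))
    (p : H10 (Ioo 0 b)) :
    |inner ℝ (h - cut c h) p.1.fst| ≤ ‖h - cut c h‖ * ((b - c) * ‖p.1.snd‖) := by
  have e : inner ℝ (h - cut c h) p.1.fst = inner ℝ (h - cut c h) (p.1.fst - cut c p.1.fst) := by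
    rw [L2.inner_def, L2.inner_def]
    refine integral_congr_ae ?_
    filter_upwards [Lp.coeFn_sub h (cut c h), cut_coeFn c h, cut_coeFn c p.1.fst,
      Lp.coeFn_sub p.1.fst (cut c p.1.fst)] with x a1 a2 a3 a4
    rw [a1, a4, Pi.sub_apply, Pi.sub_apply, a2, a3]
    by_cases hx : x ∈ Iio c
    · simp [indicator_of_mem hx]
    · simp [indicator_of_notMem hx]
  rw [e]
  exact (abs_real_inner_le_norm _ _).trans
    (mul_le_mul_of_nonneg_left (norm_fst_sub_cut_le hcb p) (norm_nonneg _))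

lemma cut_eq_self {b c : ℝ} (h : b ≤ c) (f : L2 (Ioo 0 b)) : cut c f = f := by
  refine Lp.ext ?_
  filter_upwards [cut_coeFn c f, ae_restrict_mem measurableSet_Ioo] with x h1 h2
  rw [h1, indicator_of_mem (show x ∈ Iio c from h2.2.trans_le h)]

/-- The error is that of the untruncated waves plus that of the strip removed by `cut`. The strip
has width `k (T - t)` and the `L²` norm of the removed part tends to zero, so each error is at most
`ε / 2 * (T - t)` near `T`. -/
theorem hasDerivWithinAt_toHm1 {k T : ℝ} (hk : 0 < k) {F G : ℝ → ℝ}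
    (hF : MemLp F 2) (hG : MemLp G 2) {f g : ℝ → L2 (Ioo 0 (1 + k * T))}
    (hf : Continuous f) (hg : Continuous g)
    (hfF : ∀ t, f t =ᵐ[volume.restrict (Ioo 0 (1 + k * T))] fun x => F (t - x))
    (hgG : ∀ t, g t =ᵐ[volume.restrict (Ioo 0 (1 + k * T))] fun x => G (t + x)) :
    HasDerivWithinAt (fun t => toHm1 (cut (1 + k * t) (f t - g t))) (gradPairing (f T + g T))
      (Icc 0 T) T := by
  refine (hasDerivWithinAt_iff_isLittleO (𝕜 := ℝ) (F := Hm1 (Ioo 0 (1 + k * T)))).2 ?_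
  rw [Asymptotics.isLittleO_iff]
  intro ε hε
  have c1 : Continuous fun s => ‖(f s + g s) - (f T + g T)‖ := by fun_prop
  have c2 : Continuous fun s => k * ‖(f s - g s) - cut (1 + k * s) (f s - g s)‖ :=
    continuous_const.mul ((hf.sub hg).sub (continuous_cut (hf.sub hg) (by fun_prop))).norm
  have l1 : ∀ᶠ s in 𝓝 T, ‖(f s + g s) - (f T + g T)‖ < ε / 2 :=
    c1.continuousAt.eventually_lt continuousAt_const (by simpa using hε)
  have l2 : ∀ᶠ s in 𝓝 T, k * ‖(f s - g s) - cut (1 + k * s) (f s - g s)‖ < ε / 2 :=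
    c2.continuousAt.eventually_lt continuousAt_const (by rw [cut_eq_self le_rfl]; simpa using hε)
  obtain ⟨δ, hδ, hball⟩ := Metric.eventually_nhds_iff.1 (l1.and l2)
  have hnear : ∀ᶠ t in 𝓝[Icc 0 T] T, dist t T < δ :=
    mem_nhdsWithin_of_mem_nhds (Metric.ball_mem_nhds T hδ)
  filter_upwards [hnear, self_mem_nhdsWithin] with t ht htm
  rw [Real.norm_eq_abs, abs_sub_comm, abs_of_nonneg (sub_nonneg.2 htm.2)]
  refine ContinuousLinearMap.opNorm_le_bound _
    (mul_nonneg hε.le (sub_nonneg.2 htm.2)) fun p => ?_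
  have hdist : ∀ s ∈ Icc t T, dist s T < δ := fun s hs => by
    rw [Real.dist_eq, abs_sub_comm, abs_of_nonneg (sub_nonneg.2 hs.2)]
    rw [Real.dist_eq, abs_sub_comm, abs_of_nonneg (sub_nonneg.2 htm.2)] at ht
    linarith [hs.1]
  have b1 := abs_inner_sub_le_of_profile hF hG hfF hgG htm.2
    (fun s hs => (hball (hdist s hs)).1.le) p
  have b2 := abs_inner_sub_cut_le (c := 1 + k * t) (b := 1 + k * T)
    (by nlinarith [htm.2]) (f t - g t) p
  have b3 : ‖p.1.snd‖ ≤ ‖p‖ := by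
    have : ‖p‖ ^ 2 = ‖p.1.fst‖ ^ 2 + ‖p.1.snd‖ ^ 2 := WithLp.prod_norm_sq_eq_of_L2 p.1
    exact abs_le_of_sq_le_sq' (by nlinarith [sq_nonneg ‖p.1.fst‖]) (norm_nonneg _) |>.2
  have b4 := (hball (hdist t ⟨le_rfl, htm.2⟩)).2.le
  rw [cut_eq_self le_rfl]
  simp only [sub_apply, smul_apply, toHm1_apply,
    gradPairing_apply, smul_eq_mul]
  set q := (f t - g t) - cut (1 + k * t) (f t - g t) with hq
  have hcut : cut (1 + k * t) (f t - g t) = (f t - g t) - q := by rw [hq]; abel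
  rw [hcut, inner_sub_left _ q, Real.norm_eq_abs]
  have b5 : ‖q‖ * ((1 + k * T - (1 + k * t)) * ‖p.1.snd‖) ≤ ε / 2 * (T - t) * ‖p.1.snd‖ := by
    have := mul_le_mul_of_nonneg_right b4
      (mul_nonneg (sub_nonneg.2 htm.2) (norm_nonneg p.1.snd))
    linarith
  have b6 : ε * (T - t) * ‖p.1.snd‖ ≤ ε * (T - t) * ‖p‖ :=
    mul_le_mul_of_nonneg_left b3 (mul_nonneg hε.le (sub_nonneg.2 htm.2))
  have b7 := b2.trans b5
  rw [abs_le] at b1 b7 ⊢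
  constructor <;> linarith [b1.1, b1.2, b7.1, b7.2]

/-! ### A quadratic minimization problem -/

section Quadratic

variable {H K : Type*} [NormedAddCommGroup H] [InnerProductSpace ℝ H]
  [NormedAddCommGroup K] [InnerProductSpace ℝ K]

/-- The quadratic functional `½ ‖S x - y‖² + (σ/2) ‖x‖²`. -/
def quadCost (σ : ℝ) (S : H →L[ℝ] K) (y : K) (x : H) : ℝ :=
  (1 / 2) * ‖S x - y‖ ^ 2 + (σ / 2) * ‖x‖ ^ 2

/-- The expansion of a quadratic functional about a critical point is exact; minimality and
uniqueness are both read off from it. -/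
lemma quadCost_eq_of_critical {σ : ℝ} {S : H →L[ℝ] K} {y : K} {x : H}
    (h : ∀ v, σ * inner ℝ x v + inner ℝ (S x - y) (S v) = 0) (x' : H) :
    quadCost σ S y x' = quadCost σ S y x + (1 / 2) * ‖S (x' - x)‖ ^ 2 +
      (σ / 2) * ‖x' - x‖ ^ 2 := by
  have e1 : S x' - y = (S x - y) + S (x' - x) := by rw [map_sub]; abel
  have e2 : ‖x'‖ ^ 2 = ‖x + (x' - x)‖ ^ 2 := by congr 2; abel
  have h0 := h (x' - x)
  rw [quadCost, quadCost, e1, e2, norm_add_sq_real, norm_add_sq_real]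
  linarith

/-- Lax–Milgram for `σ ⟨u, v⟩ + ⟨S u, S v⟩`, coercive with constant `σ`, and right-hand side `S* y`.
-/
lemma exists_critical [CompleteSpace H] [CompleteSpace K] {σ : ℝ} (hσ : 0 < σ) (S : H →L[ℝ] K) (y : K) :
    ∃ x, ∀ v, σ * inner ℝ x v + inner ℝ (S x - y) (S v) = 0 := by
  set B := σ • innerBilin H + (innerBilin K).bilinearComp S S with hB
  have hBa : ∀ u v, B u v = σ * inner ℝ u v + inner ℝ (S u) (S v) := fun u v => rfl
  have hco : IsCoercive B := by
    refine ⟨σ, hσ, fun u => ?_⟩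
    rw [hBa, real_inner_self_eq_norm_sq, real_inner_self_eq_norm_sq]
    nlinarith [sq_nonneg ‖S u‖]
  refine ⟨hco.continuousLinearEquivOfBilin.symm (S.adjoint y), fun v => ?_⟩
  have h := hco.continuousLinearEquivOfBilin_apply
    (hco.continuousLinearEquivOfBilin.symm (S.adjoint y)) v
  rw [ContinuousLinearEquiv.apply_symm_apply, hBa, ContinuousLinearMap.adjoint_inner_left] at h
  rw [inner_sub_left]
  linarith

lemma isMin_of_critical {σ : ℝ} (hσ : 0 < σ) {S : H →L[ℝ] K} {y : K} {x : H}
    (h : ∀ v, σ * inner ℝ x v + inner ℝ (S x - y) (S v) = 0) (x' : H) :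
    quadCost σ S y x ≤ quadCost σ S y x' := by
  rw [quadCost_eq_of_critical h x']
  nlinarith [sq_nonneg ‖S (x' - x)‖, mul_nonneg hσ.le (sq_nonneg ‖x' - x‖)]

theorem existsUnique_isMin [CompleteSpace H] [CompleteSpace K] {σ : ℝ} (hσ : 0 < σ)
    (S : H →L[ℝ] K) (y : K) :
    ∃! x, ∀ x', quadCost σ S y x ≤ quadCost σ S y x' := by
  obtain ⟨x, hx⟩ := exists_critical hσ S y
  refine ⟨x, isMin_of_critical hσ hx, fun x' hx' => ?_⟩
  have h1 := hx' x
  rw [quadCost_eq_of_critical hx x'] at h1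
  have h2 : ‖x' - x‖ ^ 2 ≤ 0 := by
    nlinarith [sq_nonneg ‖S (x' - x)‖, mul_nonneg hσ.le (sq_nonneg ‖x' - x‖)]
  have h3 : ‖x' - x‖ = 0 := by
    have := sq_nonneg ‖x' - x‖
    exact pow_eq_zero_iff (two_ne_zero) |>.1 (le_antisymm h2 this)
  exact sub_eq_zero.1 (norm_eq_zero.1 h3)

end Quadratic

/-! ### States and final states -/

lemma exists_state_of_profile {k T : ℝ} (hk0 : 0 < k) (hk1 : k < 1) (hT : 0 < T) {F : ℝ → ℝ}
    (hF : MemLp F 2) (hF0 : ∀ t ≤ 0, F t = 0) {w : Control T}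
    (hw : ∀ᵐ t ∂(volume.restrict (Ioo 0 T)), w t = F t - F (reflect k t)) :
    ∃ U u, ∃ a c : L2 (Om k T), IsState k T w U u ∧
      a =ᵐ[volume.restrict (Om k T)] (fun x => F (T - x)) ∧
      c =ᵐ[volume.restrict (Om k T)] (fun x => F (reflect k (T + x))) ∧
      u T = a - c ∧
      HasDerivWithinAt (fun t => toHm1 (u t)) (gradPairing (a + c)) (Icc 0 T) T := by
  have hG := memLp_comp_reflect hk0 hk1 hF
  obtain ⟨f, hf, hfF⟩ := exists_continuous_reflect_translate hF (Om k T)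
  obtain ⟨g, hg, hgG⟩ := exists_continuous_translate hG (Om k T)
  obtain ⟨U, hU⟩ := isState_of_profile hk0 hk1 hT hF hF0 hw hf hg hfF hgG
  exact ⟨U, _, f T, g T, hU, hfF T, hgG T, cut_eq_self (b := 1 + k * T) le_rfl (f T - g T),
    hasDerivWithinAt_toHm1 hk0 hF hG hf hg hfF hgG⟩

lemma exists_isState {k T : ℝ} (hk0 : 0 < k) (hk1 : k < 1) (hT : 0 < T) (w : Control T) :
    ∃ U u v, IsState k T w U u ∧ HasDerivWithinAt (fun t => toHm1 (u t)) v (Icc 0 T) T := by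
  obtain ⟨F, hF, hF0, hw⟩ := exists_profile hk0 hk1 w
  obtain ⟨U, u, a, c, h1, -, -, -, h2⟩ := exists_state_of_profile hk0 hk1 hT hF hF0
    ((ae_restrict_iff' measurableSet_Ioo).2 (.of_forall hw))
  exact ⟨U, u, _, h1, h2⟩

lemma hasDerivWithinAt_unique_of_eqOn {E : Type*} [NormedAddCommGroup E] [NormedSpace ℝ E] {T : ℝ}
    (hT : 0 < T) {f g : ℝ → E} {f' g' : E} (h : EqOn f g (Icc 0 T))
    (hf : HasDerivWithinAt f f' (Icc 0 T) T) (hg : HasDerivWithinAt g g' (Icc 0 T) T) :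
    f' = g' := by
  have hTm : T ∈ Icc 0 T := ⟨hT.le, le_rfl⟩
  exact (uniqueDiffOn_Icc hT T hTm).eq_deriv _ hf (hg.congr h (h hTm))

lemma IsFinalState.unique {k T : ℝ} (hk0 : 0 < k) (hk1 : k < 1) (hT : 0 < T)
    {w : Control T} {z z' : L2 (Om k T) × Hm1 (Om k T)} (h : IsFinalState k T w z)
    (h' : IsFinalState k T w z') : z = z' := by
  obtain ⟨U, u, hu, hy, hv⟩ := h
  obtain ⟨U', u', hu', hy', hv'⟩ := h'
  obtain rfl := hu.isTransposition.unique hk0 hk1 hu'.isTransposition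
  have heq := hu.curve_unique hT hu'
  have h1 : z.1 = z'.1 := by rw [← hy, ← hy', heq ⟨hT.le, le_rfl⟩]
  have h2 : z.2 = z'.2 := hasDerivWithinAt_unique_of_eqOn (E := Hm1 (Om k T)) hT
    (fun t ht => congrArg toHm1 (heq ht)) hv hv'
  exact Prod.ext h1 h2

theorem existsUnique_isFinalState {k T : ℝ} (hk0 : 0 < k) (hk1 : k < 1) (hT : 0 < T)
    (w : Control T) : ∃! z, IsFinalState k T w z := by
  obtain ⟨U, u, v, hu, hv⟩ := exists_isState hk0 hk1 hT w
  have h : IsFinalState k T w (u T, v) := ⟨U, u, hu, rfl, hv⟩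
  exact ⟨(u T, v), h, fun z hz => hz.unique hk0 hk1 hT h⟩

/-- The solution operator of the state equation. -/
theorem exists_solutionOperator {k T : ℝ} (hk0 : 0 < k) (hk1 : k < 1) (hT : 0 < T) :
    ∃ S : Control T →L[ℝ] L2 (Q k T), ∀ w U, IsTransposition k T w U ↔ U = S w := by
  choose S₀ u v hS _ using fun w => exists_isState (T := T) hk0 hk1 hT w
  have hS' : ∀ w, IsTransposition k T w (S₀ w) := fun w => (hS w).isTransposition
  let S₁ : Control T →ₗ[ℝ] L2 (Q k T) :=
    { toFun := S₀
      map_add' := fun w w' =>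
        (hS' (w + w')).unique hk0 hk1 ((hS' w).add hk0 (hS' w'))
      map_smul' := fun c w => (hS' (c • w)).unique hk0 hk1 ((hS' w).smul hk0 c) }
  have hiff : ∀ w U, IsTransposition k T w U ↔ U = S₁ w := fun w U =>
    ⟨fun h => h.unique hk0 hk1 (hS' w), fun h => h ▸ hS' w⟩
  -- Boundedness without energy estimates: the graph is cut out by identities that are continuous in
  -- both the control and the state.
  refine ⟨ContinuousLinearMap.ofIsClosedGraph (g := S₁) ?_, hiff⟩
  have : (S₁.graph : Set (Control T × L2 (Q k T))) = {p | IsTransposition k T p.1 p.2} := by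
    ext p
    rw [SetLike.mem_coe, LinearMap.mem_graph_iff]
    exact (hiff p.1 p.2).symm
  rw [this]
  exact isClosed_isTransposition hk0

lemma cost_eq {k T σ : ℝ} (ut U : L2 (Q k T)) (w : Control T) :
    cost k T σ ut U w = (1 / 2) * ‖U - ut‖ ^ 2 + (σ / 2) * ‖w‖ ^ 2 := by
  rw [cost, norm_sq_eq_integral, norm_sq_eq_integral]
  congr 2
  refine integral_congr_ae ?_
  filter_upwards [Lp.coeFn_sub U ut] with p hp
  rw [hp, Pi.sub_apply]

/-- By linearity the leader only shifts the target of the follower, to `ut - S w₁`. -/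
lemma isNash_iff {k T σ : ℝ} (hk0 : 0 < k) (hk1 : k < 1) (hT : 0 < T)
    {S : Control T →L[ℝ] L2 (Q k T)} (hS : ∀ w U, IsTransposition k T w U ↔ U = S w)
    (ut : L2 (Q k T)) (w₁ w₂ : Control T) :
    IsNash k T σ ut w₁ w₂ ↔
      ∀ v₂, quadCost σ S (ut - S w₁) w₂ ≤ quadCost σ S (ut - S w₁) v₂ := by
  have hc : ∀ v, cost k T σ ut (S (w₁ + v)) v = quadCost σ S (ut - S w₁) v := fun v => by
    rw [cost_eq, quadCost, map_add]
    congr 4; abel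
  constructor
  · rintro ⟨U, u, hU, hmin⟩ v₂
    obtain ⟨V, v, -, hV, -⟩ := exists_isState hk0 hk1 hT (w₁ + v₂)
    have h := hmin v₂ V v hV
    rwa [(hS _ _).1 hU.isTransposition, (hS _ _).1 hV.isTransposition, hc, hc] at h
  · intro h
    obtain ⟨U, u, -, hU, -⟩ := exists_isState hk0 hk1 hT (w₁ + w₂)
    refine ⟨U, u, hU, fun v₂ V v hV => ?_⟩
    rw [(hS _ _).1 hU.isTransposition, (hS _ _).1 hV.isTransposition, hc, hc]
    exact h v₂

/-- The critical equation, written in terms of the sum `w`, is an explicit formula for `w₂`; no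
equation has to be solved to recover the leader. -/
lemma exists_isNash_add_eq {k T σ : ℝ} (hk0 : 0 < k) (hk1 : k < 1) (hT : 0 < T) (hσ : 0 < σ)
    (ut : L2 (Q k T)) (w : Control T) : ∃ w₁ w₂, w₁ + w₂ = w ∧ IsNash k T σ ut w₁ w₂ := by
  obtain ⟨S, hS⟩ := exists_solutionOperator hk0 hk1 hT
  set w₂ : Control T := σ⁻¹ • S.adjoint (ut - S w) with hw₂
  refine ⟨w - w₂, w₂, sub_add_cancel _ _, ?_⟩
  rw [isNash_iff hk0 hk1 hT hS]
  refine isMin_of_critical hσ fun v => ?_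
  have e : S w₂ - (ut - S (w - w₂)) = -(ut - S w) := by rw [map_sub]; abel
  rw [e, hw₂, real_inner_smul_left, ContinuousLinearMap.adjoint_inner_left, inner_neg_left,
    mul_inv_cancel_left₀ hσ.ne']
  ring

/-! ### Exact controllability -/

lemma unreflect_reflect {k : ℝ} (hk0 : 0 < k) (hk1 : k < 1) (t : ℝ) :
    unreflect k (reflect k t) = t := by
  have : 1 - k ≠ 0 := by linarith
  have : 1 + k ≠ 0 := by linarith
  unfold unreflect reflect; field_simp; ring

lemma unreflect_le {k ξ ξ' : ℝ} (hk0 : 0 < k) (hk1 : k < 1) (h : ξ ≤ ξ') :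
    unreflect k ξ ≤ unreflect k ξ' := by
  have : (ξ + 1) / (1 - k) ≤ (ξ' + 1) / (1 - k) :=
    div_le_div_of_nonneg_right (by linarith) (by linarith)
  unfold unreflect
  nlinarith

/-- The first condition prescribes `F` on `(T - (1 + k T), T)`, the second on `(reflect k T, T - (1
+ k T))`. These intervals are disjoint, and `reflect k T > 0` means exactly `T > 2 / (1 - k)`, the
time of travel to the moving end and back; elsewhere `F` is zero. -/
lemma exists_profile_of_data {k T : ℝ} (hk0 : 0 < k) (hk1 : k < 1) (hT : 2 / (1 - k) < T)
    (p r : L2 (Om k T)) : ∃ F : ℝ → ℝ, MemLp F 2 ∧ (∀ t ≤ 0, F t = 0) ∧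
      (∀ x ∈ Om k T, F (T - x) = p x) ∧ ∀ x ∈ Om k T, F (reflect k (T + x)) = r x := by
  have hk1' : 0 < 1 - k := by linarith
  have hT' : 2 < T * (1 - k) := (div_lt_iff₀ hk1').1 hT
  have hm : ∀ q : L2 (Om k T), MemLp ((Om k T).indicator q) 2 := fun q =>
    (memLp_indicator_iff_restrict (measurableSet_Ioo : MeasurableSet (Om k T))).2 (Lp.memLp q)
  have hend : unreflect k (T - (1 + k * T)) = T + (1 + k * T) := by
    have : 1 - k ≠ 0 := hk1'.ne'
    unfold unreflect; field_simp; ring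
  have hout : ∀ (q : L2 (Om k T)) x, x ≤ 0 ∨ 1 + k * T ≤ x → (Om k T).indicator q x = 0 := by
    intro q x hx
    refine indicator_of_notMem (fun h => ?_) _
    rcases hx with hx | hx
    · exact (not_lt.2 hx) h.1
    · exact (not_lt.2 hx) h.2
  refine ⟨fun ξ => (Om k T).indicator p (T - ξ) + (Om k T).indicator r (unreflect k ξ - T),
    ?_, fun t ht => ?_, fun x hx => ?_, fun x hx => ?_⟩
  · refine MemLp.add ?_ ?_
    · have e : (fun ξ => (Om k T).indicator p (T - ξ)) =
          fun ξ => (Om k T).indicator p (-1 * ξ + T) := by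
        ext ξ; congr 1; ring
      rw [e]
      exact memLp_comp_affine (hm p) (by norm_num) T
    · have hc : (1 + k) / (1 - k) ≠ 0 := (div_pos (by linarith) hk1').ne'
      have e : (fun ξ => (Om k T).indicator r (unreflect k ξ - T)) = fun ξ =>
          (Om k T).indicator r ((1 + k) / (1 - k) * ξ + (1 + (1 + k) / (1 - k) - T)) := by
        ext ξ; congr 1; unfold unreflect; ring
      rw [e]
      exact memLp_comp_affine (hm r) hc _
  · have h0 : unreflect k 0 = 2 / (1 - k) := by
      unfold unreflect; field_simp; ring
    have := unreflect_le hk0 hk1 ht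
    dsimp only
    rw [hout p _ (Or.inr (by nlinarith)), hout r _ (Or.inl (by linarith)), add_zero]
  · have := unreflect_le hk0 hk1 (show T - (1 + k * T) ≤ T - x by linarith [hx.2])
    dsimp only
    rw [hout r _ (Or.inr (by linarith)), sub_sub_cancel, indicator_of_mem hx, add_zero]
  · have h1 : reflect k (T + x) ≤ T - (1 + k * T) := by
      by_contra! h
      have := unreflect_le hk0 hk1 h.le
      rw [hend, unreflect_reflect hk0 hk1] at this
      linarith [hx.2]
    dsimp only
    rw [hout p _ (Or.inr (by linarith)), unreflect_reflect hk0 hk1, add_sub_cancel_left,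
      indicator_of_mem hx, zero_add]

/-- If the velocity is `gradPairing v`, the two waves must satisfy `p - r = y` and `p + r = v`. -/
theorem exists_control {k T : ℝ} (hk0 : 0 < k) (hk1 : k < 1) (hT : 2 / (1 - k) < T)
    (z : L2 (Om k T) × Hm1 (Om k T)) : ∃ w, IsFinalState k T w z := by
  have hT0 : 0 < T := lt_trans (div_pos two_pos (by linarith)) hT
  obtain ⟨y, L⟩ := z
  obtain ⟨v, hv⟩ : ∃ v : L2 (Om k T), gradPairing v = L :=
    gradPairing_surjective (b := 1 + k * T) (by positivity) L
  set p : L2 (Om k T) := (2⁻¹ : ℝ) • (v + y) with hp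
  set r : L2 (Om k T) := (2⁻¹ : ℝ) • (v - y) with hr
  obtain ⟨F, hF, hF0, hFp, hFr⟩ := exists_profile_of_data hk0 hk1 hT p r
  have hw : MemLp (fun t => F t - F (reflect k t)) 2 (volume.restrict (Ioo 0 T)) :=
    (hF.sub (memLp_comp_reflect hk0 hk1 hF)).restrict _
  obtain ⟨U, u, a, c, hu, ha, hc, huT, hder⟩ :=
    exists_state_of_profile hk0 hk1 hT0 hF hF0 (w := hw.toLp _) hw.coeFn_toLp
  have hap : a = p := by
    refine Lp.ext ?_
    filter_upwards [ha, ae_restrict_mem (measurableSet_Ioo : MeasurableSet (Om k T))] with x h1 h2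
    rw [h1, hFp x h2]
  have hcr : c = r := by
    refine Lp.ext ?_
    filter_upwards [hc, ae_restrict_mem (measurableSet_Ioo : MeasurableSet (Om k T))] with x h1 h2
    rw [h1, hFr x h2]
  have e1 : a - c = y := by rw [hap, hcr, hp, hr]; module
  have e2 : a + c = v := by rw [hap, hcr, hp, hr]; module
  rw [e2] at hder
  exact ⟨hw.toLp _, U, u, hu, huT.trans e1, hv ▸ hder⟩

/-- From `e^s - 1 ≥ s` the assumed time exceeds `2 (1 + k) / (1 - k)³`, which is at least `2 / (1 -
k)` because `(1 - k)² ≤ 1 + k`. -/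
lemma controllability_time_lt {k T : ℝ} (hk0 : 0 < k) (hk1 : k < 1)
    (hT : (Real.exp (2 * k * (1 + k) / (1 - k) ^ 3) - 1) / k < T) : 2 / (1 - k) < T := by
  refine lt_of_le_of_lt ?_ hT
  have h1 := Real.add_one_le_exp (2 * k * (1 + k) / (1 - k) ^ 3)
  have hk1' : 0 < 1 - k := by linarith
  rw [le_div_iff₀ hk0]
  refine le_trans ?_ (le_sub_iff_add_le.2 h1)
  rw [div_mul_eq_mul_div, div_le_div_iff₀ hk1' (by positivity)]
  have h2 : (1 - k) ^ 2 ≤ 1 + k := by nlinarith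
  have h3 := mul_le_mul_of_nonneg_left h2 (show 0 ≤ 2 * k * (1 - k) by positivity)
  nlinarith

end MovingString

end

/-! ### The main theorem -/

theorem theorem4p1 (k T σ : ℝ) (hk0 : 0 < k) (hk1 : k < 1)
    (hT : (Real.exp (2 * k * (1 + k) / (1 - k) ^ 3) - 1) / k < T) (hσ : 0 < σ)
    (ut : MovingString.L2 (MovingString.Q k T)) :
    (∀ w₁ : MovingString.Control T, ∃! w₂ : MovingString.Control T,
      MovingString.IsNash k T σ ut w₁ w₂) ∧
    (∀ w₁ w₂ : MovingString.Control T, MovingString.IsNash k T σ ut w₁ w₂ →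
      ∃! z : MovingString.L2 (MovingString.Om k T) × MovingString.Hm1 (MovingString.Om k T),
        MovingString.IsFinalState k T (w₁ + w₂) z) ∧
    Dense {z : MovingString.L2 (MovingString.Om k T) × MovingString.Hm1 (MovingString.Om k T) |
      ∃ w₁ w₂ : MovingString.Control T, MovingString.IsNash k T σ ut w₁ w₂ ∧
        MovingString.IsFinalState k T (w₁ + w₂) z} := by
  have hT2 := MovingString.controllability_time_lt hk0 hk1 hT
  have hT0 : 0 < T := lt_trans (div_pos two_pos (by linarith)) hT2
  obtain ⟨S, hS⟩ := MovingString.exists_solutionOperator hk0 hk1 hT0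
  refine ⟨fun w₁ => ?_, fun w₁ w₂ _ => MovingString.existsUnique_isFinalState hk0 hk1 hT0 _, ?_⟩
  · simp only [MovingString.isNash_iff hk0 hk1 hT0 hS]
    exact MovingString.existsUnique_isMin hσ S _
  -- The set is in fact the whole space: a control steering to `z` is split into a leader and its
  -- equilibrium response.
  · convert dense_univ
    refine eq_univ_of_forall fun z => ?_
    obtain ⟨w, hw⟩ := MovingString.exists_control hk0 hk1 hT2 z
    obtain ⟨w₁, w₂, rfl, h⟩ := MovingString.exists_isNash_add_eq hk0 hk1 hT0 hσ ut w
    exact ⟨w₁, w₂, h, hw⟩
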